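/- **Theorem (the classic models of computation are equivalent).** Let $k\ge 0$ and let $f:\mathbb N^k\to\mathbb N$ be a partial function. The following three conditions are pairwise equivalent. 1. *$f$ is Turing-computable.* There is a deterministic one-tape Turing machine $M=(Q,q_0,F,\Sigma,\Gamma,\delta)$ such that, for all $\vec x=(x_1,\dots,x_k)\in\mathbb N^k$: if $f(\vec x)=p$, then on the input word $\overline{x_1}\#\cdots\#\overline{x_k}$ the machine halts in a final state with tape contents exactly the word $\overline{p}$ and the head on the first symbol of $\overline p$; if $f(\vec x)$ is undefined, then on that input $M$ runs forever. Here $Q$ and $\Gamma$ are finite, $q_0\in Q$, $F\subseteq Q$, $\Sigma=\{0,1,\#\}\subseteq\Gamma$, $\Gamma$ contains a blank $\mathbb B\notin\Sigma$, and $\delta:Q\times\Gamma\to Q\times\Gamma\times\{\leftarrow,\rightarrow\}$ is a partial function; the tape is infinite in both directions, a word is placed on it surrounded by blanks, the computation starts in $q_0$ with the head on the first symbol of the input (on a blank if the input is empty), and $M$ halts when it is in a final state or when $\delta$ is undefined. The number $0$ is written as the word $0$, and $n>0$ as $n$ consecutive symbols $1$. 2. *$f$ is partial recursive.* That is, $f$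 belongs to the smallest class of partial functions $\mathbb N^m\to\mathbb N$ ($m\ge 0$) that contains the zero functions $\vec x\mapsto 0$, the successor function and all projections, and is closed under composition $g(h_1(\vec x),\dots,h_l(\vec x))$, under primitive recursion $f(\vec x,0)=g(\vec x)$, $f(\vec x,m+1)=h(\vec x,m,f(\vec x,m))$ (a value being undefined when a value needed to compute it is), and under minimalization, which takes $g$ to the function whose value at $\vec x$ is the $y$ such that $g(\vec x,y)=0$ and $g(\vec x,d)$ is defined and nonzero for all $d<y$, and which is undefined at $\vec x$ if there is no such $y$. 3. *$f$ is $\lambda$-definable.* There is a term $F$ of the untyped $\lambda$-calculus (terms being taken up to renaming of bound variables) such that, for all $x_1,\dots,x_k\in\mathbb N$: if $f(x_1,\dots,x_k)=p$, then $F\,\overline{x_1}\cdots\overline{x_k}=_\beta\overline p$; if $f(x_1,\dots,x_k)$ is undefined, then $F\,\overline{x_1}\cdots\overline{x_k}$ has no $\beta$-normal form. Here $\overline n=\lambda xy.\,x(x(\cdots(x\,y)))$, with $n$ occurrences of $x$ in the body, is the Church numeral of $n$. -/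

import Mathlib

namespace ClassicModels

/-! ### Partial recursive functions -/

/-- The `k`-tuple of values of `k` partial results; it is defined iff all of them are. -/
def partTuple {k : ℕ} (p : Fin k → Part ℕ) : Part (Fin k → ℕ) :=
  ⟨∀ i, (p i).Dom, fun H i => (p i).get (H i)⟩

/-- Composition `x ↦ g (h₁ x, …, hₗ x)`; defined iff all `hᵢ x` are, and `g` is at their values. -/
def composition {k l : ℕ} (g : (Fin l → ℕ) →. ℕ) (h : Fin l → (Fin k → ℕ) →. ℕ) :
    (Fin k → ℕ) →. ℕ :=
  fun x => (partTuple fun i => h i x).bind g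

/-- The tuple `(x₁, …, xₖ, y)`. -/
def extend {k : ℕ} (x : Fin k → ℕ) (y : ℕ) : Fin (k + 1) → ℕ :=
  Fin.snoc (α := fun _ => ℕ) x y

/-- The iterates of primitive recursion at fixed parameters `x`:
`f (x, 0) = g x` and `f (x, m + 1) = h (x, m, f (x, m))`. -/
def primRecAux {k : ℕ} (g : (Fin k → ℕ) →. ℕ) (h : (Fin (k + 2) → ℕ) →. ℕ) (x : Fin k → ℕ) :
    ℕ → Part ℕ
  | 0 => g x
  | m + 1 => (primRecAux g h x m).bind fun y => h (extend (extend x m) y)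

/-- The function of `k + 1` arguments defined by primitive recursion on the last argument. -/
def primitiveRecursion {k : ℕ} (g : (Fin k → ℕ) →. ℕ) (h : (Fin (k + 2) → ℕ) →. ℕ) :
    (Fin (k + 1) → ℕ) →. ℕ :=
  fun v => primRecAux g h (Fin.init v) (v (Fin.last k))

/-- Minimalization: the least `y` with `g (x, y) = 0`, provided that `g (x, d)` is defined
(and nonzero) for all `d < y`; undefined if there is no such `y`. -/
def minimalization {k : ℕ} (g : (Fin (k + 1) → ℕ) →. ℕ) : (Fin k → ℕ) →. ℕ :=
  fun x => Nat.rfind fun y => (g (extend x y)).map fun z => decide (z = 0)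

theorem mem_minimalization {k : ℕ} (g : (Fin (k + 1) → ℕ) →. ℕ) (x : Fin k → ℕ) (y : ℕ) :
    y ∈ minimalization g x ↔
      0 ∈ g (extend x y) ∧ ∀ d < y, ∃ z ∈ g (extend x d), z ≠ 0 := by
  refine Nat.mem_rfind.trans ?_
  simp

/-- The smallest class of partial functions `ℕᵏ → ℕ` that contains the zero functions, the
successor and the projections and is closed under composition, primitive recursion and
minimalization. -/
inductive PartialRecursive : {k : ℕ} → ((Fin k → ℕ) →. ℕ) → Prop
  | zero (k : ℕ) : PartialRecursive (fun _ : Fin k → ℕ => Part.some 0)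
  | succ : PartialRecursive (fun x : Fin 1 → ℕ => Part.some (x 0 + 1))
  | proj {k : ℕ} (i : Fin k) : PartialRecursive (fun x : Fin k → ℕ => Part.some (x i))
  | comp {k l : ℕ} {g : (Fin l → ℕ) →. ℕ} {h : Fin l → (Fin k → ℕ) →. ℕ} :
      PartialRecursive g → (∀ i, PartialRecursive (h i)) → PartialRecursive (composition g h)
  | prec {k : ℕ} {g : (Fin k → ℕ) →. ℕ} {h : (Fin (k + 2) → ℕ) →. ℕ} :
      PartialRecursive g → PartialRecursive h → PartialRecursive (primitiveRecursion g h)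
  | mu {k : ℕ} {g : (Fin (k + 1) → ℕ) →. ℕ} :
      PartialRecursive g → PartialRecursive (minimalization g)

/-! ### Turing machines -/

/-- A deterministic one-tape Turing machine `(Q, q₀, F, Σ, Γ, δ)` with input alphabet `A`,
partial transition function, and a blank symbol outside the input alphabet. -/
structure TuringMachine (A : Type) where
  Q : Type
  finite_Q : Finite Q
  start : Q
  final : Set Q
  Γ : Type
  finite_Γ : Finite Γ
  input : A ↪ Γ
  blank : Γ
  blank_ne_input : ∀ a, input a ≠ blank
  δ : Q → Γ → Option (Q × Γ × Turing.Dir)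

namespace TuringMachine

variable {A : Type}

/-- The blank is the symbol with which Mathlib's two-way infinite tapes are filled. -/
instance instInhabitedΓ (M : TuringMachine A) : Inhabited M.Γ := ⟨M.blank⟩

/-- A configuration: the current state, and the two-way infinite tape together with the
position of the head. -/
structure Cfg (M : TuringMachine A) where
  state : M.Q
  tape : Turing.Tape M.Γ

/-- One computational step. The machine has halted (value `none`) if the state is final or if no
transition is defined. -/
noncomputable def step (M : TuringMachine A) (c : M.Cfg) : Option M.Cfg :=
  open Classical in
  if c.state ∈ M.final then none
  else (M.δ c.state c.tape.head).map fun t => ⟨t.1, (c.tape.write t.2.1).move t.2.2⟩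

/-- The tape that holds the word `w`, surrounded by blanks, with the head on the first symbol. -/
def wordTape (M : TuringMachine A) (w : List A) : Turing.Tape M.Γ :=
  Turing.Tape.mk₁ (w.map M.input)

/-- The initial configuration on the input word `w`. -/
def initial (M : TuringMachine A) (w : List A) : M.Cfg := ⟨M.start, M.wordTape w⟩

/-- `c'` is reached from `c` by zero, one or more computational steps. -/
def Reaches (M : TuringMachine A) (c c' : M.Cfg) : Prop :=
  StateTransition.Reaches M.step c c'

/-- On input `w` the machine halts in a final state, the contents of the tape being exactly `v`,
with the head on the first symbol of `v`. -/
def HaltsWith (M : TuringMachine A) (w v : List A) : Prop :=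
  ∃ q ∈ M.final, M.Reaches (M.initial w) ⟨q, M.wordTape v⟩

/-- On input `w` the machine runs forever. -/
def RunsForever (M : TuringMachine A) (w : List A) : Prop :=
  ∀ c, M.Reaches (M.initial w) c → M.step c ≠ none

end TuringMachine

/-- The symbols `0`, `1` and the separator `#`. -/
inductive InputSymbol
  | zero
  | one
  | sep

/-- The number `0` is written `0`; the number `n > 0` is written as `n` consecutive `1`s. -/
def encodeNat : ℕ → List InputSymbol
  | 0 => [InputSymbol.zero]
  | n + 1 => List.replicate (n + 1) InputSymbol.one

/-- The word `w₁#w₂#⋯#wₖ`, where `wᵢ` is the word of the number `xᵢ`. -/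
def encodeTuple {k : ℕ} (x : Fin k → ℕ) : List InputSymbol :=
  List.intercalate [InputSymbol.sep] (List.ofFn fun i => encodeNat (x i))

/-- `f` is computed by some Turing machine: on the input `x` the machine halts in a final state
with output `f x` if `f x` is defined, and runs forever if it is not. -/
def TuringComputable {k : ℕ} (f : (Fin k → ℕ) →. ℕ) : Prop :=
  ∃ M : TuringMachine InputSymbol, ∀ x : Fin k → ℕ,
    (∀ p ∈ f x, M.HaltsWith (encodeTuple x) (encodeNat p)) ∧
    (¬ (f x).Dom → M.RunsForever (encodeTuple x))

/-! ### Lambda calculus -/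

/-- Terms of the untyped lambda calculus up to renaming of bound variables, by de Bruijn indices:
`var n` refers to the `n`-th enclosing abstraction counted from inside, starting with `0`, and to
a free variable if there are not that many. -/
inductive LambdaTerm
  | var : ℕ → LambdaTerm
  | app : LambdaTerm → LambdaTerm → LambdaTerm
  | lam : LambdaTerm → LambdaTerm

namespace LambdaTerm

/-- Renaming of the free variables along `ρ`. -/
def rename : (ℕ → ℕ) → LambdaTerm → LambdaTerm
  | ρ, var n => var (ρ n)
  | ρ, app M N => app (rename ρ M) (rename ρ N)
  | ρ, lam M => lam (rename (fun n => Nat.casesOn n 0 fun m => ρ m + 1) M)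

/-- Simultaneous capture-avoiding substitution of `σ n` for the free variables `n`. -/
def subst : (ℕ → LambdaTerm) → LambdaTerm → LambdaTerm
  | σ, var n => σ n
  | σ, app M N => app (subst σ M) (subst σ N)
  | σ, lam M => lam (subst (fun n => Nat.casesOn n (var 0) fun m => rename Nat.succ (σ m)) M)

/-- `M[x := N]`, where `x` is the variable bound by the abstraction with body `M`. -/
def inst (M N : LambdaTerm) : LambdaTerm :=
  subst (fun n => Nat.casesOn n N var) M

/-- `P` contracts to `P'` by replacing one occurrence of a redex `(λx.M)N` by `M[x := N]`. -/
inductive BetaStep : LambdaTerm → LambdaTerm → Prop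
  | beta (M N : LambdaTerm) : BetaStep (app (lam M) N) (inst M N)
  | appLeft {M M' : LambdaTerm} (N : LambdaTerm) : BetaStep M M' → BetaStep (app M N) (app M' N)
  | appRight (M : LambdaTerm) {N N' : LambdaTerm} : BetaStep N N' → BetaStep (app M N) (app M N')
  | lam {M M' : LambdaTerm} : BetaStep M M' → BetaStep (lam M) (lam M')

/-- Reduction by a finite, possibly empty, sequence of contractions. -/
def BetaReduces : LambdaTerm → LambdaTerm → Prop := Relation.ReflTransGen BetaStep

/-- Convertibility by a finite, possibly empty, sequence of contractions and reversed
contractions. -/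
def BetaEq : LambdaTerm → LambdaTerm → Prop := Relation.EqvGen BetaStep

/-- A term is in normal form if it contains no redex, that is, if nothing can be contracted. -/
def IsNormal (P : LambdaTerm) : Prop := ∀ P', ¬ BetaStep P P'

/-- The term has a normal form. -/
def HasNormalForm (P : LambdaTerm) : Prop := ∃ Q, BetaReduces P Q ∧ IsNormal Q

/-- The body `x(⋯(x(xy)))` of a Church numeral, where `x` and `y` have the indices `1` and `0`. -/
def churchBody : ℕ → LambdaTerm
  | 0 => var 0
  | n + 1 => app (var 1) (churchBody n)

/-- The Church numeral `λxy.x(⋯(x(xy)))` with `n` occurrences of `x` in the body. -/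
def church (n : ℕ) : LambdaTerm := lam (lam (churchBody n))

/-- The term `F x̄₁ ⋯ x̄ₖ`, with application associating to the left. -/
def appNumerals {k : ℕ} (F : LambdaTerm) (x : Fin k → ℕ) : LambdaTerm :=
  (List.ofFn x).foldl (fun M n => app M (church n)) F

end LambdaTerm

/-- `f` is represented by some term `F`: if `f x` is defined and equal to `p`, then
`F x̄₁ ⋯ x̄ₖ` is convertible to the numeral of `p`; if `f x` is undefined, it has no normal form. -/
def LambdaDefinable {k : ℕ} (f : (Fin k → ℕ) →. ℕ) : Prop :=
  ∃ F : LambdaTerm, ∀ x : Fin k → ℕ,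
    (∀ p ∈ f x, (F.appNumerals x).BetaEq (LambdaTerm.church p)) ∧
    (¬ (f x).Dom → ¬ (F.appNumerals x).HasNormalForm)

end ClassicModels

namespace ClassicModels

/-! ### Partial recursive functions and Mathlib's `Partrec` -/

/-! All three notions are compared with Mathlib's `Partrec` on `Fin k → ℕ`, the common hub. Partial
recursive functions: the generating schemes are those of `Nat.Partrec'` up to the order of
arguments, which projections can permute.

Turing machines: a configuration is a state, a symbol and two finite lists. One step is primitive
recursive, because the transition table is finite, so evaluation is partial recursive
(`TuringComputable.partrec`). Conversely, Mathlib compiles a partial recursive function into a stack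
machine working on binary numbers. Two small loops are put around it. One transcribes the input word
into a number whose base 4 digits are its symbols; the other transcribes the binary digits of `2 ^ p
- 1`, which are `p` ones, into the unary output. The program itself does all decoding. The resulting
stack machine is turned into a one-tape machine (`turingComputable_of_partrec`).

Lambda calculus: iterating the complete development of a term is cofinal among its reductions. This
gives confluence, and a computable search for the normal form (`LambdaDefinable.partrec`).
Conversely, by Kleene's normal form a partial recursive function is one unbounded search over a
primitive recursive function. Primitive recursive functions are represented by iterating on pairs,
and the search is a self-applied term (`lambdaDefinable_of_partrec`). If the search fails, its weak
head reduction is infinite; standardization then shows that there is no normal form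
(`not_hasNormalForm_of_weakHead`). -/

theorem extend_castSucc {k : ℕ} (x : Fin k → ℕ) (y : ℕ) (i : Fin k) :
    extend x y i.castSucc = x i := by simp [extend]

theorem extend_last {k : ℕ} (x : Fin k → ℕ) (y : ℕ) : extend x y (Fin.last k) = y := by
  simp [extend]

theorem primrec_extend {k : ℕ} : Primrec₂ (extend : (Fin k → ℕ) → ℕ → Fin (k + 1) → ℕ) := by
  refine Primrec.fin_curry.2 (Primrec₂.swap (Primrec.fin_curry₁.2 fun i => ?_))
  refine Fin.lastCases ?_ (fun j => ?_) i
  · exact Primrec.snd.of_eq fun p => (extend_last p.1 p.2).symm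
  · exact (Primrec.fin_app.comp Primrec.fst (Primrec.const j)).of_eq
      fun p => (extend_castSucc p.1 p.2 j).symm

theorem mem_partTuple {k : ℕ} {p : Fin k → Part ℕ} {x : Fin k → ℕ} :
    x ∈ partTuple p ↔ ∀ i, x i ∈ p i :=
  ⟨fun ⟨H, e⟩ i => e ▸ Part.get_mem (H i),
    fun h => ⟨fun i => (h i).1, funext fun i => (h i).2⟩⟩

theorem partTuple_some {k : ℕ} (x : Fin k → ℕ) :
    (partTuple fun i => Part.some (x i)) = Part.some x :=
  Part.eq_some_iff.2 (mem_partTuple.2 fun i => Part.mem_some (x i))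

theorem mem_vector_mOfFn {n : ℕ} {p : Fin n → Part ℕ} {v : List.Vector ℕ n} :
    v ∈ List.Vector.mOfFn p ↔ ∀ i, v.get i ∈ p i := by
  induction n with
  | zero => simp [List.Vector.mOfFn, pure, Part.mem_some_iff, Subsingleton.elim v List.Vector.nil]
  | succ n ih =>
    obtain ⟨a, w, rfl⟩ := v.exists_eq_cons
    simp only [List.Vector.mOfFn, Part.bind_eq_bind, Part.mem_bind_iff, ih, Fin.forall_fin_succ,
      pure, Part.mem_some_iff]
    constructor
    · rintro ⟨b, hb, u, hu, e⟩
      obtain ⟨rfl, rfl⟩ : a = b ∧ w = u := by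
        exact ⟨by simpa using congrArg List.Vector.head e,
          by simpa using congrArg List.Vector.tail e⟩
      simpa using ⟨hb, hu⟩
    · rintro ⟨ha, hw⟩
      exact ⟨a, by simpa using ha, w, by simpa using hw, rfl⟩

theorem partrec_partTuple {α : Type*} [Primcodable α] {k : ℕ} {h : Fin k → α →. ℕ}
    (hh : ∀ i, Partrec (h i)) : Partrec fun a => partTuple fun i => h i a := by
  refine ((Partrec.vector_mOfFn hh).map
    (Primrec.vector_get'.to_comp.comp Computable.snd).to₂).of_eq fun a => Part.ext fun x => ?_
  simp only [Part.mem_map_iff, mem_partTuple, mem_vector_mOfFn]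
  constructor
  · rintro ⟨v, hv, rfl⟩
    exact hv
  · intro hx
    exact ⟨List.Vector.ofFn x, by simpa using hx, by ext i; simp⟩

theorem PartialRecursive.partrec {k : ℕ} {f : (Fin k → ℕ) →. ℕ} (hf : PartialRecursive f) :
    Partrec f := by
  induction hf with
  | zero k => exact (Computable.const 0).partrec
  | succ =>
    exact (Computable.succ.comp (Computable.fin_app.comp Computable.id (Computable.const 0))).partrec
  | proj i => exact (Computable.fin_app.comp Computable.id (Computable.const i)).partrec
  | comp _ _ ihg ihh =>
    exact (partrec_partTuple ihh).bind (ihg.comp Computable.snd).to₂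
  | @prec k g h _ _ ihg ihh =>
    have hinit : Computable (fun v : Fin (k + 1) → ℕ => (Fin.init v : Fin k → ℕ)) :=
      (Primrec.fin_curry.2 (Primrec.fin_app.comp Primrec.fst
        ((Primrec.dom_finite Fin.castSucc).comp Primrec.snd)).to₂).to_comp
    have hstep : Partrec₂ fun (v : Fin (k + 1) → ℕ) (p : ℕ × ℕ) =>
        h (extend (extend (Fin.init v) p.1) p.2) :=
      ihh.comp (primrec_extend.to_comp.comp (primrec_extend.to_comp.comp
        (hinit.comp Computable.fst) (Computable.fst.comp Computable.snd))
        (Computable.snd.comp Computable.snd))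
    refine (Partrec.nat_rec (Computable.fin_app.comp Computable.id (Computable.const (Fin.last k)))
      (ihg.comp hinit) hstep).of_eq fun v => ?_
    have : ∀ m : ℕ, (Nat.rec (g (Fin.init v)) (fun y IH => IH.bind fun i =>
        h (extend (extend (Fin.init v) y) i)) m : Part ℕ) = primRecAux g h (Fin.init v) m := by
      intro m
      induction m with
      | zero => rfl
      | succ m ih => simp only [primRecAux, ← ih]
    exact this _
  | @mu k g _ ih =>
    have : Partrec₂ fun (x : Fin k → ℕ) (y : ℕ) => (g (extend x y)).map fun z => decide (z = 0) :=
      (ih.comp (primrec_extend.to_comp.comp Computable.fst Computable.snd)).map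
        (Primrec.eq.decide.comp Primrec.snd (Primrec.const 0)).to_comp.to₂
    exact Partrec.rfind this

theorem PartialRecursive.comp_total {k l : ℕ} {g : (Fin l → ℕ) →. ℕ}
    {h : Fin l → (Fin k → ℕ) → ℕ} (hg : PartialRecursive g)
    (hh : ∀ i, PartialRecursive fun x => Part.some (h i x)) :
    PartialRecursive fun x => g fun i => h i x := by
  have := PartialRecursive.comp hg hh
  refine cast (congrArg _ (funext fun x => ?_)) this
  simp only [composition, partTuple_some]
  exact Part.bind_some _ _

theorem PartialRecursive.of_primrec' {n : ℕ} {f : List.Vector ℕ n → ℕ} (hf : Nat.Primrec' f) :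
    PartialRecursive fun x : Fin n → ℕ => Part.some (f (List.Vector.ofFn x)) := by
  induction hf with
  | zero => exact .zero 0
  | succ => simpa using PartialRecursive.succ
  | get i => simpa using PartialRecursive.proj i
  | comp g _ _ ihf ihg => exact ihf.comp_total ihg
  | @prec n f g _ _ ihf ihg =>
    -- `Nat.Primrec'` recurses on the first argument and gives the step function `(m, value, x)`;
    -- `primitiveRecursion` recurses on the last and gives it `(x, m, value)`. The map `s`
    -- translates the latter, and the cyclic shift in `key` the former.
    let s : Fin (n + 2) → Fin (n + 2) :=
      Fin.cons (Fin.last n).castSucc (Fin.cons (Fin.last (n + 1)) fun i => i.castSucc.castSucc)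
    have key := (ihf.prec (ihg.comp_total fun i => PartialRecursive.proj (s i))).comp_total
      (fun i => PartialRecursive.proj (Fin.snoc (α := fun _ => Fin (n + 1)) Fin.succ 0 i))
    refine cast (congrArg _ (funext fun x => ?_)) key
    have h1 : (Fin.init fun i => x (Fin.snoc (α := fun _ => Fin (n + 1)) Fin.succ 0 i)) =
        Fin.tail x := by ext i; simp [Fin.init, Fin.tail]
    have h2 : List.Vector.ofFn x = x 0 ::ᵥ List.Vector.ofFn (Fin.tail x) := rfl
    simp only [primitiveRecursion, h1, h2, List.Vector.head_cons, List.Vector.tail_cons,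
      Fin.snoc_last]
    induction x 0 with
    | zero => rfl
    | succ m ih =>
      simp only [primRecAux, ih, Part.bind_some]
      congr 2
      ext i
      refine Fin.cases ?_ (fun i => Fin.cases ?_ (fun j => ?_) i) i
      · simp [s, extend_castSucc, extend_last]
      · simp only [s, Fin.cons_succ, Fin.cons_zero, List.Vector.get_ofFn, extend_last]
        rfl
      · simp [s, extend_castSucc, Fin.tail]

theorem PartialRecursive.of_partrec' {n : ℕ} {f : List.Vector ℕ n →. ℕ} (hf : Nat.Partrec' f) :
    PartialRecursive fun x : Fin n → ℕ => f (List.Vector.ofFn x) := by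
  induction hf with
  | prim hf => exact .of_primrec' hf
  | @comp m n f g _ _ ihf ihg =>
    refine cast (congrArg _ (funext fun x => ?_)) (PartialRecursive.comp ihf ihg)
    refine Part.ext fun y => ?_
    constructor
    · intro h
      obtain ⟨v, hv, hy⟩ := Part.mem_bind_iff.1 h
      exact Part.mem_bind_iff.2 ⟨List.Vector.ofFn v,
        mem_vector_mOfFn.2 (by simpa using mem_partTuple.1 hv), hy⟩
    · intro h
      obtain ⟨v, hv, hy⟩ := Part.mem_bind_iff.1 h
      exact Part.mem_bind_iff.2 ⟨v.get, mem_partTuple.2 (mem_vector_mOfFn.1 hv), by simpa using hy⟩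
  | @rfind n f _ ih =>
    -- The search variable is the first argument for `Nat.Partrec'` and the last one for
    -- `minimalization`.
    have key := (ih.comp_total
      (fun i => PartialRecursive.proj
      ((Fin.cons (Fin.last n) Fin.castSucc : Fin (n + 1) → Fin (n + 1)) i))).mu
    refine cast (congrArg _ (funext fun x => ?_)) key
    have : ∀ y, (List.Vector.ofFn fun i => extend x y
        ((Fin.cons (Fin.last n) Fin.castSucc : Fin (n + 1) → Fin (n + 1)) i)) =
        y ::ᵥ List.Vector.ofFn x := by
      intro y
      ext i
      refine Fin.cases ?_ (fun j => ?_) i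
      · simp [extend_last]
      · simp [extend_castSucc]
    simp only [minimalization, this]
    congr 1

theorem partialRecursive_iff_partrec {k : ℕ} {f : (Fin k → ℕ) →. ℕ} :
    PartialRecursive f ↔ Partrec f := by
  refine ⟨PartialRecursive.partrec, fun hf => ?_⟩
  have : Partrec fun v : List.Vector ℕ k => f v.get :=
    hf.comp Primrec.vector_get'.to_comp
  refine cast (congrArg _ (funext fun x => ?_))
    (PartialRecursive.of_partrec' (Nat.Partrec'.of_part this))
  congr 1
  ext i
  simp

/-! ### Turing-computable functions are partial recursive -/

theorem eval_map_of_step_map {σ τ : Type} {f : σ → Option σ} {g : τ → Option τ} {tr : σ → τ}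
    (H : ∀ a, g (tr a) = (f a).map tr) (a : σ) :
    StateTransition.eval g (tr a) = (StateTransition.eval f a).map tr := by
  refine StateTransition.tr_eval' f g tr (StateTransition.fun_respects.2 fun a => ?_) a
  rcases h : f a with _ | b
  · simp [StateTransition.FRespects, H, h]
  · exact Relation.TransGen.single (by simp [H, h])

/-- With a separator before every block, all blocks are treated alike; only the very first separator
has to be removed. -/
theorem intercalate_singleton {α : Type*} (s : α) (L : List (List α)) :
    List.intercalate [s] L = (L.flatMap fun w => s :: w).tail := by
  induction L with
  | nil => rfl
  | cons w L ih =>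
    cases L with
    | nil => simp [List.intercalate]
    | cons w' L =>
      rw [List.intercalate_cons_cons, ih]
      simp

namespace TuringMachine

variable (M : TuringMachine InputSymbol)

noncomputable instance instPrimcodableQ : Primcodable M.Q :=
  haveI := M.finite_Q
  Primcodable.ofEquiv _ (Finite.equivFin M.Q)

noncomputable instance instPrimcodableΓ : Primcodable M.Γ :=
  haveI := M.finite_Γ
  Primcodable.ofEquiv _ (Finite.equivFin M.Γ)

instance instFiniteQ : Finite M.Q := M.finite_Q

instance instFiniteΓ : Finite M.Γ := M.finite_Γ

/-- The transition to be made, with the direction as a truth value that says whether the head moves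
to the left. -/
noncomputable def transition (p : M.Q × M.Γ) : Option (M.Q × M.Γ × Bool) :=
  open Classical in
  if p.1 ∈ M.final then none
  else (M.δ p.1 p.2).map fun t => (t.1, t.2.1, decide (t.2.2 = Turing.Dir.left))

/-- One step on a configuration whose tape is given by the head symbol and two finite lists. -/
noncomputable def listStep (c : M.Q × M.Γ × List M.Γ × List M.Γ) :
    Option (M.Q × M.Γ × List M.Γ × List M.Γ) :=
  (M.transition (c.1, c.2.1)).map fun t =>
    bif t.2.2 then (t.1, c.2.2.1.headI, c.2.2.1.tail, t.2.1 :: c.2.2.2)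
    else (t.1, c.2.2.2.headI, t.2.1 :: c.2.2.1, c.2.2.2.tail)

/-- The configuration described by finite lists. -/
def ofLists (c : M.Q × M.Γ × List M.Γ × List M.Γ) : M.Cfg :=
  ⟨c.1, ⟨c.2.1, Turing.ListBlank.mk c.2.2.1, Turing.ListBlank.mk c.2.2.2⟩⟩

/-- Running off the end of a list is harmless: `headI` of the empty list is the blank, as on the
infinite tape. -/
theorem step_ofLists (c : M.Q × M.Γ × List M.Γ × List M.Γ) :
    M.step (M.ofLists c) = (M.listStep c).map M.ofLists := by
  obtain ⟨q, a, l, r⟩ := c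
  by_cases hq : q ∈ M.final
  · simp [step, listStep, transition, ofLists, hq]
  · rcases h : M.δ q a with _ | ⟨q', b, d⟩
    · simp [step, listStep, transition, ofLists, hq, h]
    · cases d <;>
        simp [step, listStep, transition, ofLists, hq, h, Turing.Tape.write, Turing.Tape.move]

theorem primrec_listStep : Primrec M.listStep := by
  -- Any function on a finite type is primitive recursive, so nothing effective is needed of `δ` or
  -- of the set of final states.
  have ht : Primrec M.transition := Primrec.dom_finite _
  refine Primrec.option_map
    (ht.comp (Primrec.pair Primrec.fst (Primrec.fst.comp Primrec.snd))) ?_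
  have hl : Primrec fun p : (M.Q × M.Γ × List M.Γ × List M.Γ) × (M.Q × M.Γ × Bool) =>
      p.1.2.2.1 := Primrec.fst.comp (Primrec.snd.comp (Primrec.snd.comp Primrec.fst))
  have hr : Primrec fun p : (M.Q × M.Γ × List M.Γ × List M.Γ) × (M.Q × M.Γ × Bool) =>
      p.1.2.2.2 := Primrec.snd.comp (Primrec.snd.comp (Primrec.snd.comp Primrec.fst))
  have hq : Primrec fun p : (M.Q × M.Γ × List M.Γ × List M.Γ) × (M.Q × M.Γ × Bool) =>
      p.2.1 := Primrec.fst.comp Primrec.snd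
  have hb : Primrec fun p : (M.Q × M.Γ × List M.Γ × List M.Γ) × (M.Q × M.Γ × Bool) =>
      p.2.2.1 := Primrec.fst.comp (Primrec.snd.comp Primrec.snd)
  have hd : Primrec fun p : (M.Q × M.Γ × List M.Γ × List M.Γ) × (M.Q × M.Γ × Bool) =>
      p.2.2.2 := Primrec.snd.comp (Primrec.snd.comp Primrec.snd)
  exact Primrec.cond hd
    (hq.pair ((Primrec.list_headI.comp hl).pair
      ((Primrec.list_tail.comp hl).pair (Primrec.list_cons.comp hb hr))))
    (hq.pair ((Primrec.list_headI.comp hr).pair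
      ((Primrec.list_cons.comp hb hl).pair (Primrec.list_tail.comp hr))))

theorem primrec_encodeTuple (k : ℕ) :
    Primrec fun x : Fin k → ℕ => (encodeTuple x).map M.input := by
  have hn : Primrec fun n : ℕ => (encodeNat n).map M.input := by
    refine (Primrec.ite (Primrec.eq.comp Primrec.id (Primrec.const 0))
      (Primrec.const [M.input .zero]) (Primrec.list_map Primrec.list_range
        (Primrec.const (M.input .one)).to₂)).of_eq fun n => ?_
    cases n with
    | zero => rfl
    | succ n => simp [encodeNat]
  have ho : Primrec fun x : Fin k → ℕ => List.ofFn fun i => x i :=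
    Primrec.list_ofFn fun i => Primrec.fin_app.comp Primrec.id (Primrec.const i)
  refine (Primrec.list_tail.comp (Primrec.list_flatMap ho
    (Primrec.list_cons.comp (Primrec.const (M.input .sep))
      (hn.comp Primrec.snd)).to₂)).of_eq fun x => ?_
  simp only [encodeTuple, intercalate_singleton, List.map_tail, List.map_flatMap, List.map_cons]
  congr 1
  simp only [List.flatMap_def, List.map_ofFn]
  rfl

/-- The number of symbols `1` at the head and to the right of it. -/
noncomputable def countOnes (c : M.Q × M.Γ × List M.Γ × List M.Γ) : ℕ :=
  open Classical in ((c.2.1 :: c.2.2.2).filter (· = M.input .one)).length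

theorem primrec_countOnes : Primrec M.countOnes := by
  classical
  have h : PrimrecPred fun a : M.Γ => a = M.input .one :=
    Primrec.eq.comp Primrec.id (Primrec.const _)
  exact (Primrec.list_length.comp ((Primrec.listFilter h).comp (Primrec.list_cons.comp
    (Primrec.fst.comp Primrec.snd)
      (Primrec.snd.comp (Primrec.snd.comp Primrec.snd))))).of_eq fun c => rfl

/-- Two lists that describe the same half-tape differ only by trailing blanks, and the blank is not
`1`. -/
theorem filter_length_eq_of_mk_eq {l l' : List M.Γ}
    (h : Turing.ListBlank.mk l = Turing.ListBlank.mk l') :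
    open Classical in (l.filter (· = M.input .one)).length =
      (l'.filter (· = M.input .one)).length := by
  classical
  have hb : ∀ n, (List.replicate n (default : M.Γ)).filter (· = M.input .one) = [] := fun n =>
    List.filter_eq_nil_iff.2 fun a ha => by
      rw [List.eq_of_mem_replicate ha, decide_eq_true_iff]
      exact (M.blank_ne_input _).symm
  rcases Quotient.exact h with ⟨n, rfl⟩ | ⟨n, rfl⟩ <;> simp [hb]

/-- Counting the symbols `1` decodes the output in both cases, since the word `0` contains none. -/
theorem countOnes_of_ofLists_eq {c : M.Q × M.Γ × List M.Γ × List M.Γ} {q : M.Q} {n : ℕ}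
    (h : M.ofLists c = ⟨q, M.wordTape (encodeNat n)⟩) : M.countOnes c = n := by
  classical
  obtain ⟨q', a, l, r⟩ := c
  simp only [ofLists, wordTape, Turing.Tape.mk₁, Turing.Tape.mk₂, Turing.Tape.mk', Cfg.mk.injEq,
    Turing.Tape.mk.injEq] at h
  have h' : Turing.ListBlank.mk (a :: r) =
      Turing.ListBlank.mk ((encodeNat n).map M.input) := by
    rw [← Turing.ListBlank.cons_mk, h.2.1, h.2.2.2, Turing.ListBlank.cons_head_tail]
  refine (M.filter_length_eq_of_mk_eq h').trans ?_
  cases n with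
  | zero => simp [encodeNat]
  | succ n => simp [encodeNat]

end TuringMachine

theorem TuringComputable.partrec {k : ℕ} {f : (Fin k → ℕ) →. ℕ} (hf : TuringComputable f) :
    Partrec f := by
  obtain ⟨M, hM⟩ := hf
  let start (x : Fin k → ℕ) : M.Q × M.Γ × List M.Γ × List M.Γ :=
    (M.start, ((encodeTuple x).map M.input).headI, [], ((encodeTuple x).map M.input).tail)
  have hstart : Primrec start := (Primrec.const M.start).pair
    ((Primrec.list_headI.comp (M.primrec_encodeTuple k)).pair
      ((Primrec.const []).pair (Primrec.list_tail.comp (M.primrec_encodeTuple k))))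
  have hof : ∀ x, M.ofLists (start x) = M.initial (encodeTuple x) := fun x => by
    simp [TuringMachine.ofLists, start, TuringMachine.initial, TuringMachine.wordTape,
      Turing.Tape.mk₁, Turing.Tape.mk₂, Turing.Tape.mk']
  have hstep : Partrec (StateTransition.eval M.listStep) := by
    refine Partrec.fix (Computable.partrec ?_)
    refine (Primrec.option_casesOn M.primrec_listStep (Primrec.sumInl.comp Primrec.id)
      (Primrec.sumInr.comp Primrec.snd).to₂).to_comp.of_eq fun c => ?_
    cases M.listStep c <;> rfl
  have heval : ∀ x, StateTransition.eval M.step (M.initial (encodeTuple x)) =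
      (StateTransition.eval M.listStep (start x)).map M.ofLists := fun x => by
    rw [← hof]
    exact eval_map_of_step_map M.step_ofLists _
  refine ((hstep.comp hstart.to_comp).map
    (M.primrec_countOnes.to_comp.comp Computable.snd).to₂).of_eq fun x => ?_
  by_cases hx : (f x).Dom
  · obtain ⟨p, hp⟩ := Part.dom_iff_mem.1 hx
    obtain ⟨q, hq, hr⟩ := (hM x).1 p hp
    have hmem : (⟨q, M.wordTape (encodeNat p)⟩ : M.Cfg) ∈
        StateTransition.eval M.step (M.initial (encodeTuple x)) :=
      StateTransition.mem_eval.2 ⟨hr, by simp [TuringMachine.step, hq]⟩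
    rw [heval] at hmem
    obtain ⟨c, hc, hcq⟩ := (Part.mem_map_iff _).1 hmem
    rw [Part.eq_some_iff.2 hc, Part.eq_some_iff.2 hp, Part.map_some,
      M.countOnes_of_ofLists_eq hcq]
  -- A value of the evaluation would come from a halting configuration, against `RunsForever`.
  · rw [Part.eq_none_iff'.2 hx, Part.eq_none_iff]
    intro n hn
    obtain ⟨c, hc, -⟩ := (Part.mem_map_iff _).1 hn
    have hmem := Part.mem_map M.ofLists hc
    rw [← heval] at hmem
    obtain ⟨h1, h2⟩ := StateTransition.mem_eval.1 hmem
    exact (hM x).2 hx _ h1 h2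

/-! ### From stack machines to one-tape Turing machines -/

/-! ### Simulation between deterministic transition systems -/

section Simulation

variable {σ τ : Type} {f : σ → Option σ} {g : τ → Option τ} {tr : σ → τ → Prop}

/-- Unlike in `StateTransition.Respects`, nothing is required of `g` where `f` halts: the simulating
machine may go on from there to tidy up its tape or to write the output. -/
theorem exists_reaches_of_mem_eval
    (H : ∀ a b a', f a = some b → tr a a' → ∃ b', tr b b' ∧ StateTransition.Reaches₁ g a' b')
    {a b : σ} {a' : τ} (ha : tr a a') (hb : b ∈ StateTransition.eval f a) :
    ∃ b', tr b b' ∧ StateTransition.Reaches g a' b' := by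
  have := (StateTransition.mem_eval.1 hb).1
  clear hb
  induction this with
  | refl => exact ⟨a', ha, .refl⟩
  | tail _ h ih =>
    obtain ⟨c', hc, hr⟩ := ih
    obtain ⟨d', hd, hs⟩ := H _ _ _ h hc
    exact ⟨d', hd, hr.trans hs.to_reflTransGen⟩

theorem not_dom_eval_of_simulation
    (H : ∀ a b a', f a = some b → tr a a' → ∃ b', tr b b' ∧ StateTransition.Reaches₁ g a' b')
    {a : σ} {a' : τ} (ha : tr a a') (hn : ¬ (StateTransition.eval f a).Dom) :
    ¬ (StateTransition.eval g a').Dom := by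
  -- Restricted to what is reachable from `a`, the relation never meets a halting configuration of
  -- `f`, so the missing half of `Respects` is vacuous.
  have key : StateTransition.Respects f g
      fun b b' => tr b b' ∧ StateTransition.Reaches f a b := by
    intro b b' hb
    rcases h : f b with _ | c
    · exact (hn (Part.dom_iff_mem.2 ⟨b, StateTransition.mem_eval.2 ⟨hb.2, h⟩⟩)).elim
    · obtain ⟨c', hc, hr⟩ := H _ _ _ h hb.1
      exact ⟨c', ⟨hc, hb.2.tail h⟩, hr⟩
  rwa [StateTransition.tr_eval_dom key ⟨ha, .refl⟩]

theorem eval_eq_of_reaches {a b : σ} (h : StateTransition.Reaches f a b) :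
    StateTransition.eval f a = StateTransition.eval f b :=
  StateTransition.reaches_eval h

end Simulation

/-! ### From Post–Turing machines to one-tape machines -/

section TM0

open Turing

variable {A Γ Λ : Type} [Inhabited Γ] [Inhabited Λ]

/-- The transition function of a machine that applies `mark` to the symbol under the head, then
simulates the Post–Turing machine `P` on the states in `S`, and finally applies `unmark` to the
symbol under the head. A writing step of `P` is followed by a move to the right and back. -/
noncomputable def simulationδ (P : TM0.Machine Γ Λ) (S : Set Λ) (h : default ∈ S)
    (mark unmark : Γ → Γ) :
    (S × Bool) ⊕ Fin 4 → Γ → Option (((S × Bool) ⊕ Fin 4) × Γ × Dir)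
  | .inr 0, a => some (.inr 1, mark a, .right)
  | .inr 1, a => some (.inl (⟨default, h⟩, false), a, .left)
  | .inr 2, a => some (.inr 3, a, .left)
  | .inr 3, _ => none
  | .inl (q, true), a => some (.inl (q, false), a, .left)
  | .inl (q, false), a =>
    open Classical in
    match P q a with
    | none => some (.inr 2, unmark a, .right)
    | some (q', s) =>
      if hq : q' ∈ S then
        match s with
        | .move d => some (.inl (⟨q', hq⟩, false), a, d)
        | .write b => some (.inl (⟨q', hq⟩, true), b, .right)
      else none

/-- A Post–Turing step either writes or moves, while here every step does both; a move forth and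
back makes up the difference. The finite set `S` supplies finitely many states. The maps `mark` and
`unmark` allow the simulated tape to differ from the word in the symbol under the head. -/
theorem exists_turingMachine_of_TM0 [Finite Γ] (input : A ↪ Γ) (hin : ∀ a, input a ≠ default)
    (P : TM0.Machine Γ Λ) (S : Set Λ) (hfin : S.Finite) (hS : TM0.Supports P S)
    (mark unmark : Γ → Γ) :
    ∃ M : TuringMachine A, ∀ w : List A,
      let T : Tape Γ := Tape.mk₁ (w.map input)
      let E := StateTransition.eval (TM0.step P) ⟨default, T.write (mark T.head)⟩
      (∀ c ∈ E, ∀ v : List A, c.Tape.write (unmark c.Tape.head) = Tape.mk₁ (v.map input) →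
        M.HaltsWith w v) ∧ (¬ E.Dom → M.RunsForever w) := by
  have hS0 : default ∈ S := hS.1
  let M : TuringMachine A :=
    { Q := (S × Bool) ⊕ Fin 4
      finite_Q := haveI := hfin.to_subtype; inferInstance
      start := .inr 0
      final := {.inr 3}
      Γ := Γ
      finite_Γ := inferInstance
      input := input
      blank := default
      blank_ne_input := hin
      δ := simulationδ P S hS0 mark unmark }
  have hstep : ∀ (q : M.Q) (T : Tape Γ), q ≠ .inr 3 → M.step ⟨q, T⟩ =
      (simulationδ P S hS0 mark unmark q T.head).map
        fun t => (⟨t.1, (T.write t.2.1).move t.2.2⟩ : M.Cfg) := by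
    intro q T hq
    exact if_neg hq
  -- The flag `false` means that a step of `P` is complete; `true` means that the move back after a
  -- writing is still due.
  let run (c : TM0.Cfg Γ Λ) (c' : M.Cfg) : Prop :=
    ∃ h : c.q ∈ S, c' = ⟨.inl (⟨c.q, h⟩, false), c.Tape⟩
  have hsim : ∀ a b a', TM0.step P a = some b → run a a' →
      ∃ b', run b b' ∧ StateTransition.Reaches₁ M.step a' b' := by
    rintro ⟨q, T⟩ b _ hb ⟨hq, rfl⟩
    obtain ⟨⟨q', s⟩, hs, rfl⟩ := Option.map_eq_some_iff.1 hb
    have hq' : q' ∈ S := hS.2 hs hq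
    refine ⟨_, ⟨hq', rfl⟩, ?_⟩
    have h1 := hstep (.inl (⟨q, hq⟩, false)) T (by simp)
    simp only [simulationδ, hs, dif_pos hq'] at h1
    cases s with
    | move d =>
      refine Relation.TransGen.single ?_
      rw [Option.mem_def, h1]
      simp [Tape.write_self]
    | write b =>
      refine Relation.TransGen.head h1 (Relation.TransGen.single ?_)
      rw [Option.mem_def, hstep _ _ (by simp)]
      simp [simulationδ, Tape.write_self]
  refine ⟨M, ?_⟩
  intro w T E
  have hinit : M.Reaches (M.initial w) ⟨.inl (⟨default, hS0⟩, false), T.write (mark T.head)⟩ := by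
    have h1 := hstep (.inr 0) T (Sum.inr_injective.ne (by decide))
    refine Relation.ReflTransGen.head h1 (Relation.ReflTransGen.single ?_)
    rw [Option.mem_def, hstep _ _ (Sum.inr_injective.ne (by decide))]
    simp [simulationδ, Tape.write_self]
  constructor
  · intro c hc v hv
    obtain ⟨_, ⟨hq, rfl⟩, hr⟩ := exists_reaches_of_mem_eval hsim ⟨hS0, rfl⟩ hc
    refine ⟨.inr 3, rfl, hinit.trans (hr.trans ?_)⟩
    have hnone : P c.q c.Tape.head = none := by
      simpa [TM0.step] using (StateTransition.mem_eval.1 hc).2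
    have h1 := hstep (.inl (⟨c.q, hq⟩, false)) c.Tape (by simp)
    simp only [simulationδ, hnone] at h1
    refine Relation.ReflTransGen.head h1 (Relation.ReflTransGen.single ?_)
    rw [Option.mem_def, hstep _ _ (Sum.inr_injective.ne (by decide))]
    simp only [simulationδ, Option.map_some, Tape.write_self, Tape.move_right_left, hv]
    rfl
  · intro hE c hc hnone
    have := not_dom_eval_of_simulation hsim ⟨hS0, rfl⟩ hE
    rw [← eval_eq_of_reaches hinit] at this
    exact this (Part.dom_iff_mem.2 ⟨c, StateTransition.mem_eval.2 ⟨hc, hnone⟩⟩)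

end TM0

/-! ### From stack machines to one-tape machines -/

section TM2

open Turing

/-- The translations of stack machines to `TM1` and then to `TM0` are followed by the previous
construction. The tops of the stacks lie to the right on the tape, hence the reversed words. -/
theorem exists_turingMachine_of_TM2 {A K Λ σ : Type} {Γ : K → Type} [DecidableEq K] [Fintype K]
    [∀ k, Fintype (Γ k)] [Inhabited Λ] [Inhabited σ] [Fintype σ] (P : Λ → TM2.Stmt Γ Λ σ)
    (S : Finset Λ) (hS : TM2.Supports P S) (io : K) (e : A ↪ Γ io) :
    ∃ M : TuringMachine A, ∀ w : List A,
      let E := StateTransition.eval (TM2.step P) (TM2.init io (w.map e).reverse)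
      (∀ c ∈ E, ∀ v : List A, c.stk = Function.update (fun _ => []) io (v.map e).reverse →
        M.HaltsWith w v) ∧ (¬ E.Dom → M.RunsForever w) := by
  -- A cell carries one layer for each stack; an input symbol fills the layer `io` alone.
  let column (a : A) : ∀ k, Option (Γ k) := Function.update (fun _ => none) io (some (e a))
  have hcol : ∀ a, column a io = some (e a) := fun a => by simp [column]
  let input : A ↪ TM2to1.Γ' K Γ :=
    ⟨fun a => (false, column a), fun a b h => e.injective (Option.some.inj (by
      rw [← hcol a, ← hcol b]; exact congrArg (fun p => p.2 io) h))⟩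
  have hin : ∀ a, input a ≠ default := fun a h => by
    have := congrArg (fun p => p.2 io) h
    rw [show (input a).2 io = some (e a) from hcol a] at this
    cases this
  -- The Boolean flags the cell at the bottom of the stacks. It is the cell under the head both at
  -- the start and at the end.
  let mark (a : TM2to1.Γ' K Γ) : TM2to1.Γ' K Γ := (true, a.2)
  let unmark (a : TM2to1.Γ' K Γ) : TM2to1.Γ' K Γ := (false, a.2)
  obtain ⟨M, hM⟩ := exists_turingMachine_of_TM0 input hin (TM1to0.tr (TM2to1.tr P))
    _ (Finset.finite_toSet _) (TM1to0.tr_supports _ (TM2to1.tr_supports P hS)) mark unmark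
  refine ⟨M, ?_⟩
  intro w E
  have hinit : (Tape.mk₁ (w.map input)).write (mark (Tape.mk₁ (w.map input)).head) =
      Tape.mk₁ (TM2to1.trInit io (w.map e).reverse) := by
    have h1 : (w.map e).reverse.reverse.map
        (fun a => ((false, Function.update (fun _ => none) io (some a)) : TM2to1.Γ' K Γ)) =
        w.map input := by
      rw [List.reverse_reverse, List.map_map]
      rfl
    have h2 : TM2to1.trInit io (w.map e).reverse =
        mark (w.map input).headI :: (w.map input).tail := by
      rw [← h1]
      rfl
    rw [h2]
    rfl
  have hstart := TM2to1.trCfg_init (Λ := Λ) (σ := σ) io (w.map e).reverse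
  obtain ⟨hM1, hM2⟩ := hM w
  constructor
  · rintro ⟨l, x, St⟩ hc v hv
    replace hv : St = _ := hv
    obtain ⟨c1, hc1, he1⟩ := StateTransition.tr_eval (TM2to1.tr_respects P) hstart hc
    obtain ⟨c0, hc0, he0⟩ := StateTransition.tr_eval (TM1to0.tr_respects (TM2to1.tr P)) rfl he1
    refine hM1 c0 (by rw [hinit]; exact he0) v ?_
    subst hc0
    obtain ⟨L, hL⟩ := hc1
    -- The final stacks determine every layer of the tape; all layers but `io` are blank.
    have hL' : L = ListBlank.mk (v.map column) := by
      refine ListBlank.ext fun n => funext fun k => ?_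
      rw [TM2to1.stk_nth_val n (hL k), congrFun hv k, ListBlank.nth_mk,
        List.getI_eq_getElem?_getD, List.getElem?_map]
      by_cases hk : k = io
      · subst hk
        rw [Function.update_self, List.reverse_reverse, List.getElem?_map]
        cases v[n]?
        · rfl
        · exact (hcol _).symm
      · rw [Function.update_of_ne hk]
        cases v[n]?
        · rfl
        · exact (Function.update_of_ne hk (some (e _)) fun _ => none).symm
    have hmap : (v.map column).map (fun x => ((false, x) : TM2to1.Γ' K Γ)) = v.map input := by
      rw [List.map_map]
      rfl
    subst hL'
    rw [← hmap]
    cases v <;> rfl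
  · intro hE
    refine hM2 ?_
    rw [hinit]
    rw [← StateTransition.tr_eval_dom (TM2to1.tr_respects P) hstart,
      ← StateTransition.tr_eval_dom (TM1to0.tr_respects (TM2to1.tr P)) rfl] at hE
    exact hE

end TM2

/-! ### A stack machine that reads and writes words around a program for a unary function -/

section WordMachine

open Turing Turing.PartrecToTM2 Turing.ToPartrec

instance instFintypeInputSymbol : Fintype InputSymbol :=
  ⟨⟨{.zero, .one, .sep}, by simp⟩, fun x => by cases x <;> simp⟩

instance instFintypeK' : Fintype K' :=
  ⟨⟨{.main, .rev, .aux, .stack}, by simp⟩, fun x => by cases x <;> simp⟩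

/-- The alphabets of the stacks: one more stack, for words, in addition to Mathlib's four. -/
@[reducible]
def wordAlphabet : Option K' → Type
  | none => InputSymbol
  | some _ => Γ'

instance instFintypeWordAlphabet : ∀ k, Fintype (wordAlphabet k)
  | none => instFintypeInputSymbol
  | some _ => inferInstanceAs (Fintype Γ')

/-- The statements of the machine; the labels `inl i` belong to the reading and writing of words. -/
abbrev WordStmt : Type := TM2.Stmt wordAlphabet (Fin 4 ⊕ Λ') (Option Γ')

/-- A statement of Mathlib's machine, with halting replaced by a jump to the writing part. -/
def liftStmt : TM2.Stmt (fun _ : K' => Γ') Λ' (Option Γ') → WordStmt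
  | .push k f q => .push (some k) f (liftStmt q)
  | .peek k f q => .peek (some k) f (liftStmt q)
  | .pop k f q => .pop (some k) f (liftStmt q)
  | .load a q => .load a (liftStmt q)
  | .branch p q₁ q₂ => .branch p (liftStmt q₁) (liftStmt q₂)
  | .goto l => .goto fun v => .inr (l v)
  | .halt => .goto fun _ => .inl 2

/-- An input symbol as a value of the store of Mathlib's machine. -/
def symbolCode : InputSymbol → Γ'
  | .zero => .bit0
  | .one => .bit1
  | .sep => .cons

/-- The machine: it turns the word on stack `none` into a binary number on the main stack, computes,
and writes the digits of the result as a word on stack `none`, the empty sequence of digits being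
written as `0`. -/
def wordProgram (c : Code) : Fin 4 ⊕ Λ' → WordStmt
  | .inl 0 => .push (some .main) (fun _ => Γ'.cons) <| .push (some .main) (fun _ => Γ'.bit1) <|
      .goto fun _ => .inl 1
  | .inl 1 => .pop none (fun _ a => Option.map symbolCode a) <|
      .branch (fun v => v.isNone) (.goto fun _ => .inr (trNormal c .halt)) <|
      .push (some .main) (fun v => if v = some .cons then Γ'.bit1 else Γ'.bit0) <|
      .push (some .main) (fun v => if v = some .bit1 then Γ'.bit1 else Γ'.bit0) <|
      .goto fun _ => .inl 1
  | .inl 2 => .pop (some .main) (fun _ a => a) <|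
      .branch (fun v => v = some .bit1)
        (.push none (fun _ => InputSymbol.one) <| .goto fun _ => .inl 3)
        (.push none (fun _ => InputSymbol.zero) .halt)
  | .inl 3 => .pop (some .main) (fun _ a => a) <|
      .branch (fun v => v = some .bit1)
        (.push none (fun _ => InputSymbol.one) <| .goto fun _ => .inl 3) .halt
  | .inr q => liftStmt (tr q)

theorem liftStmt_supports {S : Finset Λ'} (T : Finset (Fin 4)) (hT : 2 ∈ T) :
    ∀ {q : TM2.Stmt (fun _ : K' => Γ') Λ' (Option Γ')}, TM2.SupportsStmt S q →
      TM2.SupportsStmt (T.disjSum S) (liftStmt q)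
  | .push _ _ q, h | .peek _ _ q, h | .pop _ _ q, h | .load _ q, h =>
    liftStmt_supports T hT (q := q) h
  | .branch _ _ _, h => ⟨liftStmt_supports T hT h.1, liftStmt_supports T hT h.2⟩
  | .goto _, h => fun v => Finset.inr_mem_disjSum.2 (h v)
  | .halt, _ => fun _ => Finset.inl_mem_disjSum.2 hT

instance instInhabitedLabel : Inhabited (Fin 4 ⊕ Λ') := ⟨.inl 0⟩

theorem wordProgram_supports (c : Code) :
    TM2.Supports (wordProgram c) (Finset.univ.disjSum (codeSupp c .halt)) := by
  have hl : ∀ i : Fin 4, (Sum.inl i : Fin 4 ⊕ Λ') ∈ Finset.univ.disjSum (codeSupp c .halt) :=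
    fun i => Finset.inl_mem_disjSum.2 (Finset.mem_univ i)
  refine ⟨hl 0, ?_⟩
  rintro (i | q) hq
  · fin_cases i
    · exact fun _ => hl 1
    · exact ⟨fun _ => Finset.inr_mem_disjSum.2 (tr_supports c .halt).1, fun _ => hl 1⟩
    · exact ⟨fun _ => hl 3, trivial⟩
    · exact ⟨fun _ => hl 3, trivial⟩
  · exact liftStmt_supports _ (Finset.mem_univ _)
      ((tr_supports c .halt).2 q (Finset.inr_mem_disjSum.1 hq))

/-- The stacks of Mathlib's machine together with a word. -/
def addWord (w : List InputSymbol) (S : K' → List Γ') : ∀ k, List (wordAlphabet k)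
  | none => w
  | some k => S k

theorem addWord_none (w : List InputSymbol) (S : K' → List Γ') : addWord w S none = w := rfl

theorem addWord_some (w : List InputSymbol) (S : K' → List Γ') (k : K') :
    addWord w S (some k) = S k := rfl

theorem update_addWord_some (w : List InputSymbol) (S : K' → List Γ') (k : K') (l : List Γ') :
    Function.update (addWord w S) (some k) l = addWord w (Function.update S k l) := by
  funext k'
  rcases k' with _ | k'
  · rfl
  · by_cases h : k' = k
    · subst h
      exact (Function.update_self (some k') l (addWord w S)).trans (Function.update_self k' l S).symm
    · change Function.update (addWord w S) (some k) l (some k') =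
        Function.update S k l k'
      rw [Function.update_of_ne h]
      exact Function.update_of_ne (by simpa using h) _ _

theorem update_addWord_none (w v : List InputSymbol) (S : K' → List Γ') :
    Function.update (addWord w S) none v = addWord v S := by
  funext k'
  rcases k' with _ | k' <;> rfl

theorem update_empty (w : List InputSymbol) :
    (Function.update (fun _ => []) none w : ∀ k, List (wordAlphabet k)) =
      addWord w (K'.elim [] [] [] []) := by
  funext k
  rcases k with _ | _ | _ | _ | _ <;> rfl

/-- A configuration of Mathlib's machine, with a halting one understood as the beginning of the
writing part. -/
def liftCfg (w : List InputSymbol) (c : TM2.Cfg (fun _ : K' => Γ') Λ' (Option Γ')) :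
    TM2.Cfg wordAlphabet (Fin 4 ⊕ Λ') (Option Γ') :=
  ⟨some (c.l.elim (.inl 2) .inr), c.var, addWord w c.stk⟩

theorem stepAux_liftStmt (w : List InputSymbol) :
    ∀ (q : TM2.Stmt (fun _ : K' => Γ') Λ' (Option Γ')) (v : Option Γ') (S : K' → List Γ'),
      TM2.stepAux (liftStmt q) v (addWord w S) = liftCfg w (TM2.stepAux q v S)
  | .push k f q, v, S => by
    simp only [liftStmt, TM2.stepAux, ← stepAux_liftStmt w q, ← update_addWord_some]
    rfl
  | .peek k f q, v, S => by
    simp only [liftStmt, TM2.stepAux, ← stepAux_liftStmt w q]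
    rfl
  | .pop k f q, v, S => by
    simp only [liftStmt, TM2.stepAux, ← stepAux_liftStmt w q, ← update_addWord_some]
    rfl
  | .load a q, v, S => by simp only [liftStmt, TM2.stepAux, ← stepAux_liftStmt w q]
  | .branch p q₁ q₂, v, S => by
    simp only [liftStmt, TM2.stepAux]
    cases p v
    · exact stepAux_liftStmt w q₂ v S
    · exact stepAux_liftStmt w q₁ v S
  | .goto l, v, S => rfl
  | .halt, v, S => rfl

theorem step_liftCfg (c : Code) (w : List InputSymbol)
    {a b : TM2.Cfg (fun _ : K' => Γ') Λ' (Option Γ')} (h : TM2.step tr a = some b) :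
    TM2.step (wordProgram c) (liftCfg w a) = some (liftCfg w b) := by
  obtain ⟨_ | q, v, S⟩ := a
  · cases h
  · obtain rfl := Option.some.inj h
    exact congrArg some (stepAux_liftStmt w _ v S)

/-- The number whose digits in base `4` are the symbols of the word, with a leading digit `1`. -/
def wordNumber : List InputSymbol → ℕ
  | [] => 1
  | .zero :: w => 4 * wordNumber w
  | .one :: w => 4 * wordNumber w + 1
  | .sep :: w => 4 * wordNumber w + 2

theorem wordNumber_pos (w : List InputSymbol) : 0 < wordNumber w := by
  induction w with
  | nil => exact Nat.one_pos
  | cons a w ih => cases a <;> simp only [wordNumber] <;> omega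

/-- Positivity matters because `0` has no binary digits at all. This is why `wordNumber` has a
leading digit `1`: the digits pushed on top of it always form a proper binary numeral. -/
theorem trNat_bit0 {n : ℕ} (h : 0 < n) : trNat (2 * n) = Γ'.bit0 :: trNat n := by
  obtain ⟨m, rfl⟩ := Nat.exists_eq_succ_of_ne_zero h.ne'
  simp only [trNat, Nat.two_mul, Nat.cast_add, Num.bit0_of_bit0, Nat.succ_eq_add_one, Nat.cast_one,
    Num.add_one]
  rfl

theorem trNat_bit1 (n : ℕ) : trNat (2 * n + 1) = Γ'.bit1 :: trNat n := by
  simp only [trNat, Nat.two_mul, Nat.cast_add, Nat.cast_one, Num.bit1_of_bit1]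
  cases (n : Num) <;> rfl

/-- If the program returns `2 ^ p - 1` in place of `p`, its binary digits are already the unary
output. -/
theorem trNat_two_pow_sub_one (p : ℕ) : trNat (2 ^ p - 1) = List.replicate p Γ'.bit1 := by
  induction p with
  | zero => simp
  | succ p ih =>
    have : 2 ^ (p + 1) - 1 = 2 * (2 ^ p - 1) + 1 := by
      have := Nat.one_le_two_pow (n := p)
      rw [pow_succ]
      omega
    rw [this, trNat_bit1, ih, List.replicate_succ]

/-- The word is popped from its end. The invariant is that the main stack holds the number of the
part `w` already read; each symbol adds one base 4 digit, that is, two bits with the lower one on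
top. -/
theorem reaches_read (c : Code) (u w : List InputSymbol) (v : Option Γ') :
    StateTransition.Reaches (TM2.step (wordProgram c))
      ⟨some (.inl 1), v, addWord u (K'.elim (trList [wordNumber w]) [] [] [])⟩
      (liftCfg [] (PartrecToTM2.init c [wordNumber (u.reverse ++ w)])) := by
  induction u generalizing w v with
  | nil =>
    refine Relation.ReflTransGen.single (congrArg some ?_)
    simp only [wordProgram, TM2.stepAux, addWord_none, update_addWord_none]
    rfl
  | cons a u ih =>
    have := ih (a :: w) (some (symbolCode a))
    rw [List.reverse_cons, List.append_assoc]
    refine Relation.ReflTransGen.head (congrArg some ?_) this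
    have hpos := wordNumber_pos w
    have h0 : trNat (4 * wordNumber w) = Γ'.bit0 :: Γ'.bit0 :: trNat (wordNumber w) := by
      rw [show 4 * wordNumber w = 2 * (2 * wordNumber w) by ring, trNat_bit0 (by omega),
        trNat_bit0 hpos]
    have h1 : trNat (4 * wordNumber w + 1) = Γ'.bit1 :: Γ'.bit0 :: trNat (wordNumber w) := by
      rw [show 4 * wordNumber w = 2 * (2 * wordNumber w) by ring, trNat_bit1, trNat_bit0 hpos]
    have h2 : trNat (4 * wordNumber w + 2) = Γ'.bit0 :: Γ'.bit1 :: trNat (wordNumber w) := by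
      rw [show 4 * wordNumber w + 2 = 2 * (2 * wordNumber w + 1) by ring, trNat_bit0 (by omega),
        trNat_bit1]
    simp only [wordProgram, TM2.stepAux, addWord_none, addWord_some, update_addWord_none,
      update_addWord_some]
    cases a <;> simp [symbolCode, wordNumber, trList, h0, h1, h2]

theorem reaches_write (c : Code) (m : ℕ) (u : List InputSymbol) (v : Option Γ') :
    ∃ v', StateTransition.Reaches (TM2.step (wordProgram c))
      ⟨some (.inl 3), v, addWord u (K'.elim (List.replicate m Γ'.bit1 ++ [Γ'.cons]) [] [] [])⟩
      ⟨none, v', addWord (List.replicate m .one ++ u) (K'.elim [] [] [] [])⟩ := by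
  induction m generalizing u v with
  | zero =>
    refine ⟨some .cons, Relation.ReflTransGen.single (congrArg some ?_)⟩
    simp [wordProgram, TM2.stepAux, addWord_some, update_addWord_some]
  | succ m ih =>
    obtain ⟨v', hv⟩ := ih (.one :: u) (some .bit1)
    refine ⟨v', ?_⟩
    rw [List.replicate_succ' (a := InputSymbol.one), List.append_assoc]
    refine Relation.ReflTransGen.head (congrArg some ?_) hv
    simp only [wordProgram, TM2.stepAux, addWord_none, addWord_some, update_addWord_none,
      update_addWord_some]
    simp [List.replicate_succ]

/-- If the first symbol popped is the end mark `cons`, there are no digits and `0` is written;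
otherwise the first `1` is written and the loop copies the others. -/
theorem reaches_output (c : Code) (p : ℕ) :
    ∃ v', StateTransition.Reaches (TM2.step (wordProgram c))
      (liftCfg [] (PartrecToTM2.halt [2 ^ p - 1]))
      ⟨none, v', addWord (encodeNat p) (K'.elim [] [] [] [])⟩ := by
  cases p with
  | zero =>
    refine ⟨some .cons, Relation.ReflTransGen.single (congrArg some ?_)⟩
    simp [wordProgram, TM2.stepAux, addWord_some, update_addWord_some, PartrecToTM2.halt, trList,
      addWord_none, update_addWord_none, encodeNat]
  | succ p =>
    obtain ⟨v', hv⟩ := reaches_write c p [.one] (some .bit1)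
    refine ⟨v', ?_⟩
    rw [encodeNat, List.replicate_succ']
    refine Relation.ReflTransGen.head (congrArg some ?_) hv
    simp [wordProgram, TM2.stepAux, addWord_none, addWord_some, update_addWord_none,
      update_addWord_some, PartrecToTM2.halt, trList, trNat_two_pow_sub_one, List.replicate_succ]

/-- The effect of reading a symbol on the list of the numbers read so far, the last one first. -/
def readSymbol (L : List ℕ) : InputSymbol → List ℕ
  | .zero => L
  | .one => (L.headI + 1) :: L.tail
  | .sep => 0 :: L

theorem foldl_readSymbol_sep_encodeNat (L : List ℕ) (n : ℕ) :
    (.sep :: encodeNat n).foldl readSymbol L = n :: L := by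
  have h : ∀ n m : ℕ, (List.replicate n InputSymbol.one).foldl readSymbol (m :: L) =
      (m + n) :: L := by
    intro n
    induction n with
    | zero => intro m; rfl
    | succ n ih =>
      intro m
      rw [List.replicate_succ, List.foldl_cons]
      exact (ih (m + 1)).trans (by rw [Nat.add_right_comm]; rfl)
  cases n with
  | zero => rfl
  | succ n => exact (h (n + 1) 0).trans (by rw [Nat.zero_add])

/-- The initial list `[0]` replaces the missing separator before the first number. For the empty
tuple it would be a spurious entry, hence `k + 1`. -/
theorem foldl_readSymbol_encodeTuple {k : ℕ} (x : Fin (k + 1) → ℕ) :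
    (encodeTuple x).foldl readSymbol [0] = (List.ofFn x).reverse := by
  have h : ∀ (l : List ℕ) (L : List ℕ),
      (l.flatMap fun n => .sep :: encodeNat n).foldl readSymbol L = l.reverse ++ L := by
    intro l
    induction l with
    | nil => intro L; rfl
    | cons n l ih =>
      intro L
      rw [List.flatMap_cons, List.foldl_append, foldl_readSymbol_sep_encodeNat, ih]
      simp
  have h1 : (List.ofFn x).flatMap (fun n => InputSymbol.sep :: encodeNat n) =
      .sep :: encodeTuple x := by
    rw [encodeTuple, intercalate_singleton, List.ofFn_succ, List.ofFn_succ]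
    simp [List.flatMap_def, List.map_ofFn, Function.comp_def]
  have h2 := h (List.ofFn x) []
  rw [h1, List.append_nil] at h2
  exact h2

/-- One step of decoding: remove the last digit of the number, and update the list. -/
def decodeStep (s : ℕ × List ℕ) : ℕ × List ℕ :=
  if s.1 ≤ 1 then s
  else (s.1 / 4, if s.1 % 4 = 0 then s.2 else
    if s.1 % 4 = 1 then (s.2.headI + 1) :: s.2.tail else 0 :: s.2)

theorem decodeStep_wordNumber_cons (a : InputSymbol) (w : List InputSymbol) (L : List ℕ) :
    decodeStep (wordNumber (a :: w), L) = (wordNumber w, readSymbol L a) := by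
  have := wordNumber_pos w
  cases a
  · simp [decodeStep, wordNumber, readSymbol, show ¬ 4 * wordNumber w ≤ 1 by omega]
  · simp [decodeStep, wordNumber, readSymbol, show ¬ 4 * wordNumber w + 1 ≤ 1 by omega,
      show (4 * wordNumber w + 1) / 4 = wordNumber w by omega,
      show (4 * wordNumber w + 1) % 4 = 1 by omega]
  · simp [decodeStep, wordNumber, readSymbol,
      show (4 * wordNumber w + 2) / 4 = wordNumber w by omega,
      show (4 * wordNumber w + 2) % 4 = 2 by omega]

/-- The number `1` of the empty word is a fixed point, so superfluous steps do no harm, and the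
number of the word itself can serve as the number of steps. -/
theorem iterate_decodeStep (w : List InputSymbol) (L : List ℕ) (n : ℕ) (hn : w.length ≤ n) :
    decodeStep^[n] (wordNumber w, L) = (1, w.foldl readSymbol L) := by
  induction w generalizing L n with
  | nil =>
    exact Function.iterate_fixed (by simp [decodeStep, wordNumber]) n
  | cons a w ih =>
    obtain ⟨m, rfl⟩ : ∃ m, n = m + 1 := ⟨n - 1, by simp at hn; omega⟩
    rw [Function.iterate_succ_apply, decodeStep_wordNumber_cons, ih _ _ (by simpa using hn)]
    rfl

theorem length_le_wordNumber (w : List InputSymbol) : w.length ≤ wordNumber w := by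
  induction w with
  | nil => simp
  | cons a w ih =>
    have := wordNumber_pos w
    cases a <;> simp only [wordNumber, List.length_cons] <;> omega

/-- The tuple of numbers in the word with a given number. -/
def decodeTuple (k : ℕ) (n : ℕ) : Fin k → ℕ :=
  fun i => (decodeStep^[n] (n, [0])).2.reverse.getD i 0

theorem decodeTuple_wordNumber {k : ℕ} (x : Fin k → ℕ) :
    decodeTuple k (wordNumber (encodeTuple x)) = x := by
  cases k with
  | zero => exact Subsingleton.elim _ _
  | succ k =>
    funext i
    rw [decodeTuple, iterate_decodeStep _ _ _ (length_le_wordNumber _),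
      foldl_readSymbol_encodeTuple, List.reverse_reverse, List.getD_eq_getElem _ _ (by simp; omega),
      List.getElem_ofFn]

theorem primrec_decodeTuple (k : ℕ) : Primrec (decodeTuple k) := by
  have hm : Primrec fun s : ℕ × List ℕ => s.1 % 4 := Primrec.nat_mod.comp Primrec.fst
    (Primrec.const 4)
  have hstep : Primrec decodeStep :=
    Primrec.ite (Primrec.nat_le.comp Primrec.fst (Primrec.const 1)) Primrec.id
      ((Primrec.nat_div.comp Primrec.fst (Primrec.const 4)).pair
        (Primrec.ite (Primrec.eq.comp hm (Primrec.const 0)) Primrec.snd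
          (Primrec.ite (Primrec.eq.comp hm (Primrec.const 1))
            (Primrec.list_cons.comp (Primrec.succ.comp (Primrec.list_headI.comp Primrec.snd))
              (Primrec.list_tail.comp Primrec.snd))
            (Primrec.list_cons.comp (Primrec.const 0) Primrec.snd))))
  have hiter : Primrec fun n : ℕ => (decodeStep^[n] (n, [0])).2.reverse :=
    Primrec.list_reverse.comp (Primrec.snd.comp (Primrec.nat_iterate Primrec.id
      (Primrec.id.pair (Primrec.const [0])) (hstep.comp Primrec.snd).to₂))
  exact Primrec.fin_curry.2 ((Primrec.list_getD 0).comp (hiter.comp Primrec.fst)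
    (Primrec.fin_val.comp Primrec.snd)).to₂

/-- Decoding the word and passing from `p` to `2 ^ p - 1` are computable, so both become part of the
program and the machine around it only transcribes symbols. -/
theorem exists_code_of_partrec {k : ℕ} {f : (Fin k → ℕ) →. ℕ} (hf : Partrec f) :
    ∃ c : Code, ∀ x, c.eval [wordNumber (encodeTuple x)] = (f x).map fun p => [2 ^ p - 1] := by
  have hpow : Primrec fun p : ℕ => 2 ^ p - 1 := by
    refine (Primrec.nat_rec₁ 0 (f := fun _ m => 2 * m + 1) (Primrec.succ.comp
      (Primrec.nat_mul.comp (Primrec.const 2) Primrec.snd)).to₂).of_eq fun p => ?_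
    induction p with
    | zero => rfl
    | succ p ih =>
      have := Nat.one_le_two_pow (n := p)
      simp only [ih, pow_succ]
      omega
  have hg : Partrec fun v : List.Vector ℕ 1 =>
      (f (decodeTuple k v.head)).map fun p => 2 ^ p - 1 :=
    (hf.comp ((primrec_decodeTuple k).comp Primrec.vector_head).to_comp).map
      (hpow.comp Primrec.snd).to_comp.to₂
  obtain ⟨c, hc⟩ := Code.exists_code (Nat.Partrec'.of_part hg)
  refine ⟨c, fun x => (hc (wordNumber (encodeTuple x) ::ᵥ List.Vector.nil)).trans ?_⟩
  simp only [List.Vector.head_cons, decodeTuple_wordNumber, Part.map_eq_map, Part.map_map]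
  rfl

end WordMachine

theorem turingComputable_of_partrec {k : ℕ} {f : (Fin k → ℕ) →. ℕ} (hf : Partrec f) :
    TuringComputable f := by
  obtain ⟨c, hc⟩ := exists_code_of_partrec hf
  obtain ⟨M, hM⟩ := exists_turingMachine_of_TM2 (wordProgram c) _ (wordProgram_supports c) none
    (Function.Embedding.refl InputSymbol)
  refine ⟨M, fun x => ?_⟩
  obtain ⟨hM1, hM2⟩ := hM (encodeTuple x)
  have hinit : StateTransition.Reaches (Turing.TM2.step (wordProgram c))
      (Turing.TM2.init none ((encodeTuple x).map (Function.Embedding.refl InputSymbol)).reverse)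
      (liftCfg [] (Turing.PartrecToTM2.init c [wordNumber (encodeTuple x)])) := by
    have h := reaches_read c (encodeTuple x).reverse [] none
    rw [List.reverse_reverse, List.append_nil] at h
    refine Relation.ReflTransGen.head (congrArg some ?_) h
    have hone : Turing.PartrecToTM2.trNat 1 = [.bit1] := trNat_two_pow_sub_one 1
    rw [show ((encodeTuple x).map (Function.Embedding.refl InputSymbol)) = encodeTuple x from
      List.map_id _, update_empty]
    change Turing.TM2.stepAux (wordProgram c (.inl 0)) _ _ = _
    simp [wordProgram, Turing.TM2.stepAux, addWord_some, update_addWord_some, wordNumber,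
      Turing.PartrecToTM2.trList, hone]
    rfl
  have hsim : ∀ a b a', Turing.TM2.step Turing.PartrecToTM2.tr a = some b → a' = liftCfg [] a →
      ∃ b', b' = liftCfg [] b ∧
        StateTransition.Reaches₁ (Turing.TM2.step (wordProgram c)) a' b' := by
    rintro a b _ h rfl
    exact ⟨_, rfl, Relation.TransGen.single (step_liftCfg c [] h)⟩
  have heval : StateTransition.eval (Turing.TM2.step Turing.PartrecToTM2.tr)
      (Turing.PartrecToTM2.init c [wordNumber (encodeTuple x)]) =
      (f x).map fun p => Turing.PartrecToTM2.halt [2 ^ p - 1] := by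
    rw [Turing.PartrecToTM2.tr_eval, hc, Part.map_eq_map, Part.map_map]
    rfl
  constructor
  · intro p hp
    obtain ⟨_, rfl, hr⟩ := exists_reaches_of_mem_eval hsim rfl
      (heval ▸ Part.mem_map (fun p => Turing.PartrecToTM2.halt [2 ^ p - 1]) hp)
    obtain ⟨v, hv⟩ := reaches_output c p
    refine hM1 _ (StateTransition.mem_eval.2 ⟨hinit.trans (hr.trans hv), rfl⟩) _ ?_
    rw [show ((encodeNat p).map (Function.Embedding.refl InputSymbol)) = encodeNat p from
      List.map_id _, update_empty, show (encodeNat p).reverse = encodeNat p by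
        cases p <;> simp [encodeNat]]
  · intro hx
    refine hM2 ?_
    rw [eval_eq_of_reaches hinit]
    refine not_dom_eval_of_simulation hsim rfl ?_
    rw [heval]
    exact hx

namespace LambdaTerm

/-! ### Renaming and substitution -/

/-- The substitution of `N` for the variable `0` and of `σ n` for the variable `n + 1`. -/
def scons (N : LambdaTerm) (σ : ℕ → LambdaTerm) : ℕ → LambdaTerm :=
  fun n => Nat.casesOn n N σ

/-- The renaming `ρ` under an abstraction. -/
def upRen (ρ : ℕ → ℕ) : ℕ → ℕ :=
  fun n => Nat.casesOn n 0 fun m => ρ m + 1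

/-- The substitution `σ` under an abstraction. -/
def up (σ : ℕ → LambdaTerm) : ℕ → LambdaTerm :=
  scons (var 0) fun n => rename Nat.succ (σ n)

theorem rename_lam (ρ : ℕ → ℕ) (M : LambdaTerm) :
    rename ρ (lam M) = lam (rename (upRen ρ) M) := rfl

theorem subst_lam (σ : ℕ → LambdaTerm) (M : LambdaTerm) :
    subst σ (lam M) = lam (subst (up σ) M) := rfl

theorem inst_eq (M N : LambdaTerm) : inst M N = subst (scons N var) M := rfl

theorem rename_eq_subst (ρ : ℕ → ℕ) (M : LambdaTerm) :
    rename ρ M = subst (fun n => var (ρ n)) M := by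
  induction M generalizing ρ with
  | var n => rfl
  | app M N ihM ihN => simp only [rename, subst, ihM, ihN]
  | lam M ih =>
    rw [rename_lam, subst_lam, ih]
    congr 2
    funext n
    cases n <;> rfl

theorem subst_var (M : LambdaTerm) : subst var M = M := by
  induction M with
  | var n => rfl
  | app M N ihM ihN => simp only [subst, ihM, ihN]
  | lam M ih =>
    rw [subst_lam, show up var = var by funext n; cases n <;> rfl, ih]

theorem subst_rename (σ : ℕ → LambdaTerm) (ρ : ℕ → ℕ) (M : LambdaTerm) :
    subst σ (rename ρ M) = subst (fun n => σ (ρ n)) M := by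
  induction M generalizing σ ρ with
  | var n => rfl
  | app M N ihM ihN => simp only [rename, subst, ihM, ihN]
  | lam M ih =>
    rw [rename_lam, subst_lam, subst_lam, ih]
    congr 2
    funext n
    cases n <;> rfl

theorem rename_rename (ρ' ρ : ℕ → ℕ) (M : LambdaTerm) :
    rename ρ' (rename ρ M) = rename (fun n => ρ' (ρ n)) M := by
  rw [rename_eq_subst, subst_rename, ← rename_eq_subst]

theorem rename_subst (ρ : ℕ → ℕ) (σ : ℕ → LambdaTerm) (M : LambdaTerm) :
    rename ρ (subst σ M) = subst (fun n => rename ρ (σ n)) M := by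
  induction M generalizing σ ρ with
  | var n => rfl
  | app M N ihM ihN => simp only [rename, subst, ihM, ihN]
  | lam M ih =>
    rw [subst_lam, rename_lam, subst_lam, ih]
    congr 2
    funext n
    cases n with
    | zero => rfl
    | succ n =>
      change rename (upRen ρ) (rename Nat.succ (σ n)) = rename Nat.succ (rename ρ (σ n))
      rw [rename_rename, rename_rename]
      rfl

theorem subst_subst (τ σ : ℕ → LambdaTerm) (M : LambdaTerm) :
    subst τ (subst σ M) = subst (fun n => subst τ (σ n)) M := by
  induction M generalizing σ τ with
  | var n => rfl
  | app M N ihM ihN => simp only [subst, ihM, ihN]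
  | lam M ih =>
    rw [subst_lam, subst_lam, subst_lam, ih]
    congr 2
    funext n
    cases n with
    | zero => rfl
    | succ n =>
      change subst (up τ) (rename Nat.succ (σ n)) = rename Nat.succ (subst τ (σ n))
      rw [subst_rename, rename_subst]
      rfl

theorem subst_scons_rename_succ (N : LambdaTerm) (σ : ℕ → LambdaTerm) (M : LambdaTerm) :
    subst (scons N σ) (rename Nat.succ M) = subst σ M := by
  rw [subst_rename]
  rfl

/-- Successive contractions accumulate in one simultaneous substitution; closed forms of this kind
replace calculations with shifted indices below. -/
theorem inst_subst_up (σ : ℕ → LambdaTerm) (M N : LambdaTerm) :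
    inst (subst (up σ) M) N = subst (scons N σ) M := by
  rw [inst_eq, subst_subst]
  congr 1
  funext n
  cases n with
  | zero => rfl
  | succ n => exact (subst_scons_rename_succ _ _ _).trans (subst_var _)

theorem subst_inst (σ : ℕ → LambdaTerm) (M N : LambdaTerm) :
    subst σ (inst M N) = inst (subst (up σ) M) (subst σ N) := by
  rw [inst_subst_up, inst_eq, subst_subst]
  congr 1
  funext n
  cases n <;> rfl

theorem inst_rename_succ (M N : LambdaTerm) : inst (rename Nat.succ M) N = M := by
  rw [inst_eq, subst_scons_rename_succ, subst_var]

theorem subst_church (σ : ℕ → LambdaTerm) (n : ℕ) : subst σ (church n) = church n := by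
  rw [church, subst_lam, subst_lam]
  congr 2
  induction n with
  | zero => rfl
  | succ n ih => rw [churchBody, subst, ih]; rfl

/-! ### Reduction -/

theorem BetaReduces.app {M M' N N' : LambdaTerm} (hM : BetaReduces M M') (hN : BetaReduces N N') :
    BetaReduces (app M N) (app M' N') :=
  (hM.lift (fun M => LambdaTerm.app M N) fun _ _ h => .appLeft N h).trans
    (hN.lift (fun N => LambdaTerm.app M' N) fun _ _ h => .appRight M' h)

theorem BetaReduces.lam {M M' : LambdaTerm} (hM : BetaReduces M M') :
    BetaReduces (lam M) (lam M') :=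
  hM.lift LambdaTerm.lam fun _ _ h => .lam h

/-! ### Confluence by complete developments -/

/-- Parallel reduction: contraction of any set of redexes of the term. -/
inductive Par : LambdaTerm → LambdaTerm → Prop
  | var (n : ℕ) : Par (var n) (var n)
  | app {M M' N N' : LambdaTerm} : Par M M' → Par N N' → Par (app M N) (app M' N')
  | lam {M M' : LambdaTerm} : Par M M' → Par (lam M) (lam M')
  | beta {M M' N N' : LambdaTerm} : Par M M' → Par N N' → Par (app (lam M) N) (inst M' N')

theorem Par.refl (M : LambdaTerm) : Par M M := by
  induction M with
  | var n => exact .var n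
  | app M N ihM ihN => exact .app ihM ihN
  | lam M ih => exact .lam ih

theorem BetaStep.par {M N : LambdaTerm} (h : BetaStep M N) : Par M N := by
  induction h with
  | beta M N => exact .beta (.refl M) (.refl N)
  | appLeft N _ ih => exact .app ih (.refl N)
  | appRight M _ ih => exact .app (.refl M) ih
  | lam _ ih => exact .lam ih

theorem Par.betaReduces {M N : LambdaTerm} (h : Par M N) : BetaReduces M N := by
  induction h with
  | var n => exact .refl
  | app _ _ ihM ihN => exact ihM.app ihN
  | lam _ ih => exact ih.lam
  | beta _ _ ihM ihN => exact (ihM.lam.app ihN).tail (.beta _ _)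

theorem Par.subst {M M' : LambdaTerm} (h : Par M M') {σ σ' : ℕ → LambdaTerm}
    (hσ : ∀ n, Par (σ n) (σ' n)) : Par (subst σ M) (subst σ' M') := by
  have hup : ∀ {σ σ' : ℕ → LambdaTerm}, (∀ n, Par (σ n) (σ' n)) →
      (∀ M M' : LambdaTerm, Par M M' → Par (rename Nat.succ M) (rename Nat.succ M')) →
      ∀ n, Par (up σ n) (up σ' n) := by
    intro σ σ' hσ hr n
    cases n with
    | zero => exact .var 0
    | succ n => exact hr _ _ (hσ n)
  -- Renaming comes first, because a substitution is renamed when it passes under an abstraction.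
  have hren : ∀ M M' : LambdaTerm, Par M M' → ∀ ρ, Par (rename ρ M) (rename ρ M') := by
    intro M M' h
    induction h with
    | var n => exact fun ρ => .var _
    | app _ _ ihM ihN => exact fun ρ => .app (ihM ρ) (ihN ρ)
    | lam _ ih => exact fun ρ => .lam (ih _)
    | @beta M M' N N' _ _ ihM ihN =>
      intro ρ
      have : rename ρ (inst M' N') = inst (rename (upRen ρ) M') (rename ρ N') := by
        rw [rename_eq_subst ρ (inst M' N'), subst_inst, ← rename_eq_subst ρ N',
          rename_eq_subst (upRen ρ)]
        congr 2
        funext n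
        cases n <;> rfl
      rw [this]
      exact .beta (ihM _) (ihN _)
  induction h generalizing σ σ' with
  | var n => exact hσ n
  | app _ _ ihM ihN => exact .app (ihM hσ) (ihN hσ)
  | lam _ ih => exact .lam (ih (hup hσ fun _ _ h => hren _ _ h _))
  | beta _ _ ihM ihN =>
    rw [subst_inst]
    exact .beta (ihM (hup hσ fun _ _ h => hren _ _ h _)) (ihN hσ)

theorem Par.inst {M M' N N' : LambdaTerm} (hM : Par M M') (hN : Par N N') :
    Par (inst M N) (inst M' N') :=
  hM.subst fun n => by
    cases n with
    | zero => exact hN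
    | succ n => exact .var n

/-- Whether the term is an abstraction. -/
def isLam : LambdaTerm → Bool
  | lam _ => true
  | _ => false

/-- The body of an abstraction; the term itself if it is not an abstraction. -/
def body : LambdaTerm → LambdaTerm
  | lam M => M
  | M => M

/-- The complete development: all redexes of the term are contracted. -/
def develop : LambdaTerm → LambdaTerm
  | var n => var n
  | app M N => bif M.isLam then inst (develop M).body (develop N) else app (develop M) (develop N)
  | lam M => lam (develop M)

/-- The triangle property: whichever redexes of `M` were contracted, contracting the residuals of
the others leads to the same complete development. -/
theorem Par.develop {M N : LambdaTerm} (h : Par M N) : Par N (develop M) := by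
  induction h with
  | var n => exact .var n
  | @app M M' N N' hM _ ihM ihN =>
    cases M with
    | var n => exact .app ihM ihN
    | app => exact .app ihM ihN
    | lam P =>
      cases hM with
      | lam =>
        cases ihM with
        | lam h => exact .beta h ihN
  | lam _ ih => exact .lam ih
  | beta _ _ ihM ihN => exact ihM.inst ihN

theorem betaReduces_develop (M : LambdaTerm) : BetaReduces M (develop M) :=
  (Par.refl M).develop.betaReduces

theorem BetaReduces.develop {M N : LambdaTerm} (h : BetaReduces M N) :
    BetaReduces (develop M) (develop N) := by
  induction h with
  | refl => exact .refl
  | tail _ h ih => exact ih.trans h.par.develop.develop.betaReduces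

/-- By the triangle property each single step is overtaken by one more development, and developing
preserves reduction. The developments are thus cofinal among the reducts of `M`. -/
theorem BetaReduces.exists_iterate_develop {M N : LambdaTerm} (h : BetaReduces M N) :
    ∃ n, BetaReduces N (LambdaTerm.develop^[n] M) := by
  induction h with
  | refl => exact ⟨0, .refl⟩
  | tail _ h ih =>
    obtain ⟨n, hn⟩ := ih
    refine ⟨n + 1, ?_⟩
    rw [Function.iterate_succ_apply']
    exact h.par.develop.betaReduces.trans hn.develop

theorem betaReduces_iterate_develop (n : ℕ) (M : LambdaTerm) :
    BetaReduces M (LambdaTerm.develop^[n] M) := by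
  induction n generalizing M with
  | zero => exact .refl
  | succ n ih => exact (betaReduces_develop M).trans (ih _)

theorem BetaEq.exists_common_reduct {M N : LambdaTerm} (h : BetaEq M N) :
    ∃ P, BetaReduces M P ∧ BetaReduces N P := by
  have hconf : ∀ a b c : LambdaTerm, BetaReduces a b → BetaReduces a c →
      ∃ d, BetaReduces b d ∧ BetaReduces c d := by
    intro a b c hb hc
    obtain ⟨n, hn⟩ := hb.exists_iterate_develop
    obtain ⟨m, hm⟩ := hc.exists_iterate_develop
    -- Both reducts lie below iterates on the same sequence of developments, so a later iterate
    -- joins them.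
    refine ⟨LambdaTerm.develop^[m + n] a, ?_, ?_⟩
    · rw [Function.iterate_add_apply]
      exact hn.trans (betaReduces_iterate_develop _ _)
    · rw [Nat.add_comm, Function.iterate_add_apply]
      exact hm.trans (betaReduces_iterate_develop _ _)
  induction h with
  | rel _ _ h => exact ⟨_, .single h, .refl⟩
  | refl M => exact ⟨M, .refl, .refl⟩
  | symm _ _ _ ih =>
    obtain ⟨P, h1, h2⟩ := ih
    exact ⟨P, h2, h1⟩
  | trans _ _ _ _ _ ih1 ih2 =>
    obtain ⟨P, h1, h2⟩ := ih1
    obtain ⟨Q, h3, h4⟩ := ih2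
    obtain ⟨R, h5, h6⟩ := hconf _ _ _ h2 h3
    exact ⟨R, h1.trans h5, h4.trans h6⟩

theorem IsNormal.eq_of_betaReduces {M N : LambdaTerm} (hM : IsNormal M) (h : BetaReduces M N) :
    N = M := by
  rcases h.cases_head with rfl | ⟨P, hP, -⟩
  · rfl
  · exact (hM P hP).elim

theorem BetaEq.betaReduces {M N : LambdaTerm} (h : BetaEq M N) (hN : IsNormal N) :
    BetaReduces M N := by
  obtain ⟨P, h1, h2⟩ := h.exists_common_reduct
  rwa [hN.eq_of_betaReduces h2] at h1

theorem BetaEq.exists_iterate_develop_eq {M N : LambdaTerm} (h : BetaEq M N) (hN : IsNormal N) :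
    ∃ n, LambdaTerm.develop^[n] M = N :=
  let ⟨n, hn⟩ := (h.betaReduces hN).exists_iterate_develop
  ⟨n, hN.eq_of_betaReduces hn⟩

theorem isNormal_church (n : ℕ) : IsNormal (church n) := by
  have hbody : ∀ n, IsNormal (churchBody n) := by
    intro n
    induction n with
    | zero => exact fun _ h => nomatch h
    | succ n ih =>
      intro P h
      cases h with
      | appLeft _ h => cases h
      | appRight _ h => exact ih _ h
  intro P h
  cases h with
  | lam h =>
    cases h with
    | lam h => exact hbody n _ h

theorem church_injective : Function.Injective church := by
  have hbody : ∀ n m, churchBody n = churchBody m → n = m := by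
    intro n
    induction n with
    | zero => intro m h; cases m with
      | zero => rfl
      | succ m => cases h
    | succ n ih =>
      intro m h
      cases m with
      | zero => cases h
      | succ m =>
        injection h with _ h
        rw [ih m h]
  intro n m h
  injection h with h
  injection h with h
  exact hbody n m h

/-! ### Weak head reduction and standardization -/

/-- One step of weak head reduction. -/
inductive WeakHead : LambdaTerm → LambdaTerm → Prop
  | beta (M N : LambdaTerm) : WeakHead (app (lam M) N) (inst M N)
  | app {M M' : LambdaTerm} (N : LambdaTerm) : WeakHead M M' → WeakHead (app M N) (app M' N)

/-- Weak head reduction. -/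
def WeakHeads : LambdaTerm → LambdaTerm → Prop := Relation.ReflTransGen WeakHead

theorem WeakHead.betaStep {M N : LambdaTerm} (h : WeakHead M N) : BetaStep M N := by
  induction h with
  | beta M N => exact .beta M N
  | app N _ ih => exact .appLeft N ih

theorem WeakHead.eq {M N N' : LambdaTerm} (h : WeakHead M N) (h' : WeakHead M N') : N = N' := by
  induction h generalizing N' with
  | beta M N =>
    cases h' with
    | beta => rfl
    | app _ h => cases h
  | app N h ih =>
    cases h' with
    | beta => cases h
    | app _ h' => rw [ih h']

theorem WeakHeads.app {M M' : LambdaTerm} (h : WeakHeads M M') (N : LambdaTerm) :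
    WeakHeads (app M N) (app M' N) :=
  h.lift (fun M => LambdaTerm.app M N) fun _ _ h => .app N h

theorem WeakHead.subst {M N : LambdaTerm} (h : WeakHead M N) (σ : ℕ → LambdaTerm) :
    WeakHead (subst σ M) (subst σ N) := by
  induction h with
  | beta M N =>
    rw [subst_inst]
    exact .beta _ _
  | app N _ ih => exact .app _ ih

theorem WeakHeads.subst {M N : LambdaTerm} (h : WeakHeads M N) (σ : ℕ → LambdaTerm) :
    WeakHeads (subst σ M) (subst σ N) :=
  h.lift _ fun _ _ h => h.subst σ

/-- Standard reduction: weak head reduction followed by standard reductions of the parts. -/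
inductive Standard : LambdaTerm → LambdaTerm → Prop
  | var {M : LambdaTerm} {n : ℕ} : WeakHeads M (var n) → Standard M (var n)
  | app {M A A' B B' : LambdaTerm} : WeakHeads M (app A B) → Standard A A' → Standard B B' →
      Standard M (app A' B')
  | lam {M A A' : LambdaTerm} : WeakHeads M (lam A) → Standard A A' → Standard M (lam A')

theorem Standard.refl (M : LambdaTerm) : Standard M M := by
  induction M with
  | var n => exact .var .refl
  | app M N ihM ihN => exact .app .refl ihM ihN
  | lam M ih => exact .lam .refl ih

theorem Standard.head {M M' N : LambdaTerm} (h : WeakHeads M M') (h' : Standard M' N) :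
    Standard M N := by
  cases h' with
  | var h' => exact .var (h.trans h')
  | app h' hA hB => exact .app (h.trans h') hA hB
  | lam h' hA => exact .lam (h.trans h') hA

theorem Standard.rename {M N : LambdaTerm} (h : Standard M N) (ρ : ℕ → ℕ) :
    Standard (rename ρ M) (rename ρ N) := by
  have hw : ∀ {M N : LambdaTerm} (ρ : ℕ → ℕ), WeakHeads M N →
      WeakHeads (LambdaTerm.rename ρ M) (LambdaTerm.rename ρ N) := by
    intro M N ρ h
    rw [rename_eq_subst, rename_eq_subst]
    exact h.subst _
  induction h generalizing ρ with
  | var h => exact .var (hw ρ h)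
  | app h _ _ ihA ihB => exact .app (hw ρ h) (ihA ρ) (ihB ρ)
  | lam h _ ih => exact .lam (hw ρ h) (ih _)

theorem Standard.subst {M N : LambdaTerm} (h : Standard M N) {σ τ : ℕ → LambdaTerm}
    (hσ : ∀ n, Standard (σ n) (τ n)) : Standard (subst σ M) (subst τ N) := by
  induction h generalizing σ τ with
  | var h => exact .head (h.subst σ) (hσ _)
  | app h _ _ ihA ihB => exact .app (h.subst σ) (ihA hσ) (ihB hσ)
  | lam h _ ih =>
    refine .lam (h.subst σ) (ih fun n => ?_)
    cases n with
    | zero => exact .refl _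
    | succ n => exact (hσ n).rename _

/-- A redex contracted at the root of `N` comes from an application whose function part weak head
reduces to an abstraction. Its contraction can be done already in the weak head phase, and
`Standard.subst` supplies the rest. Any other redex lies in a part. -/
theorem Standard.tail {M N P : LambdaTerm} (h : Standard M N) (h' : BetaStep N P) :
    Standard M P := by
  induction h' generalizing M with
  | beta P Q =>
    cases h with
    | app h hA hB =>
      cases hA with
      | lam hA hP =>
        refine .head ((h.trans (WeakHeads.app hA _)).tail (.beta _ _)) (hP.subst fun n => ?_)
        cases n with
        | zero => exact hB
        | succ n => exact .refl _
  | appLeft N _ ih =>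
    cases h with
    | app h hA hB => exact .app h (ih hA) hB
  | appRight M _ ih =>
    cases h with
    | app h hA hB => exact .app h hA (ih hB)
  | lam _ ih =>
    cases h with
    | lam h hA => exact .lam h (ih hA)

theorem BetaReduces.standard {M N : LambdaTerm} (h : BetaReduces M N) : Standard M N := by
  induction h with
  | refl => exact .refl M
  | tail _ h ih => exact ih.tail h

/-- The weak head phase can be completed: a remaining weak head redex would survive as a redex of
`N`. The last clause carries the induction, as it rules out that the function part becomes an
abstraction while that of `N` is none. -/
theorem Standard.exists_weakHeads {M N : LambdaTerm} (h : Standard M N) (hN : IsNormal N) :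
    ∃ P, WeakHeads M P ∧ (∀ Q, ¬ WeakHead P Q) ∧ (P.isLam = true → N.isLam = true) := by
  induction h with
  | var h => exact ⟨_, h, (fun _ h => by cases h), (fun h => by cases h)⟩
  | @app M A A' B B' h _ _ ihA _ =>
    obtain ⟨P, hP, hn, hl⟩ := ihA fun Q hQ => hN _ (.appLeft _ hQ)
    refine ⟨_, h.trans (WeakHeads.app hP B), fun Q hQ => ?_, (fun h => by cases h)⟩
    cases hQ with
    | beta =>
      cases A' with
      | lam => exact hN _ (.beta _ _)
      | var => cases hl rfl
      | app => cases hl rfl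
    | app _ hQ => exact hn _ hQ
  | lam h _ _ => exact ⟨_, h, (fun _ h => by cases h), fun _ => rfl⟩

/-- A term in a set `S` of terms each of which reduces to a term in `S` by at least one step of weak
head reduction has no normal form. -/
theorem not_hasNormalForm_of_weakHead {S : Set LambdaTerm}
    (hS : ∀ M ∈ S, ∃ N ∈ S, Relation.TransGen WeakHead M N) {M : LambdaTerm} (hM : M ∈ S) :
    ¬ HasNormalForm M := by
  rintro ⟨N, hMN, hN⟩
  obtain ⟨P, hP, hn, -⟩ := (BetaReduces.standard hMN).exists_weakHeads hN
  -- Weak head reduction is deterministic, so the path to `P` and the endless path through `S`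
  -- coincide as far as the former goes.
  have key : ∃ Q ∈ S, WeakHeads P Q := by
    clear hn
    induction hP with
    | refl => exact ⟨M, hM, .refl⟩
    | @tail P P' _ h ih =>
      obtain ⟨Q, hQ, hPQ⟩ := ih
      rcases hPQ.cases_head with rfl | ⟨P'', h', hPQ⟩
      · obtain ⟨R, hR, hPR⟩ := hS _ hQ
        obtain ⟨P'', h', hPR⟩ := Relation.TransGen.head'_iff.1 hPR
        exact ⟨R, hR, h'.eq h ▸ hPR⟩
      · exact ⟨Q, hQ, h'.eq h ▸ hPQ⟩
  obtain ⟨Q, hQ, hPQ⟩ := key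
  rcases hPQ.cases_head with rfl | ⟨P', h, -⟩
  · obtain ⟨R, -, hR⟩ := hS _ hQ
    obtain ⟨P', h, -⟩ := Relation.TransGen.head'_iff.1 hR
    exact hn _ h
  · exact hn _ h

/-! ### Convertibility -/

theorem BetaEq.refl (M : LambdaTerm) : BetaEq M M := Relation.EqvGen.refl M

theorem BetaEq.symm {M N : LambdaTerm} (h : BetaEq M N) : BetaEq N M := Relation.EqvGen.symm _ _ h

theorem BetaEq.trans {M N P : LambdaTerm} (h : BetaEq M N) (h' : BetaEq N P) : BetaEq M P :=
  Relation.EqvGen.trans _ _ _ h h'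

theorem BetaReduces.betaEq {M N : LambdaTerm} (h : BetaReduces M N) : BetaEq M N := by
  induction h with
  | refl => exact .refl M
  | tail _ h ih => exact ih.trans (.rel _ _ h)

theorem BetaEq.app {M M' N N' : LambdaTerm} (hM : BetaEq M M') (hN : BetaEq N N') :
    BetaEq (app M N) (app M' N') := by
  have hM : BetaEq (LambdaTerm.app M N) (LambdaTerm.app M' N) := by
    induction hM with
    | rel _ _ h => exact .rel _ _ (.appLeft _ h)
    | refl => exact .refl _
    | symm _ _ _ ih => exact ih.symm
    | trans _ _ _ _ _ ih ih' => exact ih.trans ih'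
  refine hM.trans ?_
  clear hM
  induction hN with
  | rel _ _ h => exact .rel _ _ (.appRight _ h)
  | refl => exact .refl _
  | symm _ _ _ ih => exact ih.symm
  | trans _ _ _ _ _ ih ih' => exact ih.trans ih'

theorem WeakHead.beta_subst (σ : ℕ → LambdaTerm) (M N : LambdaTerm) :
    WeakHead (LambdaTerm.app (LambdaTerm.subst σ (lam M)) N)
      (LambdaTerm.subst (scons N σ) M) := by
  rw [subst_lam, ← inst_subst_up]
  exact .beta _ _

theorem WeakHead.betaEq {M N : LambdaTerm} (h : WeakHead M N) : BetaEq M N :=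
  .rel _ _ h.betaStep

theorem WeakHeads.betaEq {M N : LambdaTerm} (h : WeakHeads M N) : BetaEq M N := by
  induction h with
  | refl => exact .refl M
  | tail _ h ih => exact ih.trans h.betaEq

/-! ### Church numerals -/

theorem betaReduces_church_app (n : ℕ) (M N : LambdaTerm) :
    BetaReduces (app (app (church n) M) N) (subst (scons N (scons M var)) (churchBody n)) := by
  refine .head (.appLeft _ (.beta _ _)) (.single ?_)
  rw [inst_eq, subst_lam, ← inst_subst_up]
  exact .beta _ _

theorem church_zero_app (M N : LambdaTerm) : BetaEq (app (app (church 0) M) N) N :=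
  (betaReduces_church_app 0 M N).betaEq

theorem church_succ_app (n : ℕ) (M N : LambdaTerm) :
    BetaEq (app (app (church (n + 1)) M) N) (app M (app (app (church n) M) N)) :=
  (betaReduces_church_app (n + 1) M N).betaEq.trans
    ((BetaEq.refl M).app (betaReduces_church_app n M N).betaEq.symm)

/-- The successor on Church numerals. -/
def succTerm : LambdaTerm :=
  lam (lam (lam (app (var 1) (app (app (var 2) (var 1)) (var 0)))))

theorem succTerm_app {M : LambdaTerm} {n : ℕ} (hM : BetaEq M (church n)) :
    BetaEq (app succTerm M) (church (n + 1)) := by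
  refine ((BetaEq.refl _).app hM).trans ?_
  refine BetaEq.trans (.rel _ _ (.beta _ _)) (BetaReduces.betaEq ?_)
  refine BetaReduces.lam (BetaReduces.lam (BetaReduces.app .refl ?_))
  have h := betaReduces_church_app n (var 1) (var 0)
  have e (n : ℕ) : subst (scons (var 0) (scons (var 1) var)) (churchBody n) = churchBody n := by
    induction n with
    | zero => rfl
    | succ n ih => exact congrArg (app (var 1)) ih
  have e' (ρ : ℕ → ℕ) : rename ρ (church n) = church n := by
    rw [rename_eq_subst, subst_church]
  change BetaReduces (app (app (rename Nat.succ (rename Nat.succ (church n))) (var 1)) (var 0)) _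
  rw [e] at h
  rwa [e', e']

/-! ### Pairs -/

/-- The first projection `λab.a`, as an argument for `pairTerm`. -/
def fstTerm : LambdaTerm := lam (lam (var 1))

/-- The second projection `λab.b`, as an argument for `pairTerm`. -/
def sndTerm : LambdaTerm := lam (lam (var 0))

/-- The pair `λz.zMN`. -/
def pairTerm (M N : LambdaTerm) : LambdaTerm :=
  lam (app (app (var 0) (rename Nat.succ M)) (rename Nat.succ N))

theorem subst_pairTerm (σ : ℕ → LambdaTerm) (M N : LambdaTerm) :
    subst σ (pairTerm M N) = pairTerm (subst σ M) (subst σ N) := by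
  have h (M : LambdaTerm) : subst (up σ) (rename Nat.succ M) = rename Nat.succ (subst σ M) := by
    rw [subst_rename, rename_subst]
    rfl
  rw [pairTerm, subst_lam, subst, subst, h, h]
  rfl

theorem pairTerm_app (M N P : LambdaTerm) :
    BetaEq (app (pairTerm M N) P) (app (app P M) N) := by
  have h := BetaStep.beta (app (app (var 0) (rename Nat.succ M)) (rename Nat.succ N)) P
  rw [show inst (app (app (var 0) (rename Nat.succ M)) (rename Nat.succ N)) P =
    app (app P (inst (rename Nat.succ M) P)) (inst (rename Nat.succ N) P) from rfl,
    inst_rename_succ, inst_rename_succ] at h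
  exact .rel _ _ h

theorem pairTerm_fst (M N : LambdaTerm) : BetaEq (app (pairTerm M N) fstTerm) M := by
  refine (pairTerm_app M N fstTerm).trans ?_
  refine (BetaEq.app (.rel _ _ (.beta _ _)) (.refl N)).trans ?_
  have h := BetaStep.beta (rename Nat.succ M) N
  rw [inst_rename_succ] at h
  exact .rel _ _ h

theorem pairTerm_snd (M N : LambdaTerm) : BetaEq (app (pairTerm M N) sndTerm) N :=
  (pairTerm_app M N sndTerm).trans
    ((BetaEq.app (.rel _ _ (.beta _ _)) (.refl N)).trans (.rel _ _ (.beta _ _)))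

/-! ### Primitive recursive functions -/

/-- The value of `f` is computed by the term `t`, whose free variables are the arguments. -/
def Represents {n : ℕ} (f : List.Vector ℕ n → ℕ) (t : LambdaTerm) : Prop :=
  ∀ (v : List.Vector ℕ n) (σ : ℕ → LambdaTerm),
    (∀ i : Fin n, BetaEq (σ i) (church (v.get i))) → BetaEq (subst σ t) (church (f v))

/-- Kleene's device: a numeral iterates the map `(m, F m) ↦ (m + 1, F (m + 1))` on pairs, and the
second component is the value. -/
theorem Represents.prec {n : ℕ} {f : List.Vector ℕ n → ℕ} {g : List.Vector ℕ (n + 2) → ℕ}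
    {s t : LambdaTerm} (hf : Represents f s) (hg : Represents g t) :
    ∃ r, Represents (fun v : List.Vector ℕ (n + 1) =>
      v.head.rec (f v.tail) fun y IH => g (y ::ᵥ IH ::ᵥ v.tail)) r := by
  -- The variable `0` is the current pair. The remaining parameters have indices from `1` on outside
  -- the abstraction, hence from `2` on inside it, which is just where `t` expects them.
  let τ : ℕ → LambdaTerm :=
    scons (app (var 0) fstTerm) (scons (app (var 0) sndTerm) fun i => var (i + 2))
  let step : LambdaTerm := pairTerm (app succTerm (app (var 0) fstTerm)) (subst τ t)
  refine ⟨app (app (app (var 0) (lam step)) (pairTerm (church 0) (rename Nat.succ s))) sndTerm,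
    fun v σ hσ => ?_⟩
  let F : ℕ → ℕ := fun m => m.rec (f v.tail) fun y IH => g (y ::ᵥ IH ::ᵥ v.tail)
  have htail (i : Fin n) : BetaEq (σ (i + 1)) (church (v.tail.get i)) := by
    have := hσ i.succ
    rwa [← List.Vector.get_tail_succ] at this
  have hstep (X : LambdaTerm) (m : ℕ) (h₁ : BetaEq (app X fstTerm) (church m))
      (h₂ : BetaEq (app X sndTerm) (church (F m))) :
      BetaEq (app (app (subst σ (lam step)) X) fstTerm) (church (m + 1)) ∧
      BetaEq (app (app (subst σ (lam step)) X) sndTerm) (church (F (m + 1))) := by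
    have h := (WeakHead.beta_subst σ step X).betaEq
    rw [subst_pairTerm, subst_subst] at h
    refine ⟨(h.app (.refl _)).trans ((pairTerm_fst _ _).trans (succTerm_app h₁)),
      (h.app (.refl _)).trans ((pairTerm_snd _ _).trans
        (hg (m ::ᵥ F m ::ᵥ v.tail) _ fun i => ?_))⟩
    refine Fin.cases h₁ (fun i => Fin.cases h₂ (fun i => ?_) i) i
    rw [List.Vector.get_cons_succ, List.Vector.get_cons_succ]
    exact htail i
  have hiter (m : ℕ) :
      BetaEq (app (app (app (church m) (subst σ (lam step)))
        (pairTerm (church 0) (subst (fun i => σ (i + 1)) s))) fstTerm) (church m) ∧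
      BetaEq (app (app (app (church m) (subst σ (lam step)))
        (pairTerm (church 0) (subst (fun i => σ (i + 1)) s))) sndTerm) (church (F m)) := by
    induction m with
    | zero =>
      exact ⟨((church_zero_app _ _).app (.refl _)).trans (pairTerm_fst _ _),
        ((church_zero_app _ _).app (.refl _)).trans ((pairTerm_snd _ _).trans
          (hf v.tail _ htail))⟩
    | succ m ih =>
      have h := hstep _ m ih.1 ih.2
      exact ⟨((church_succ_app m _ _).app (.refl _)).trans h.1,
        ((church_succ_app m _ _).app (.refl _)).trans h.2⟩
  have h0 : BetaEq (σ 0) (church v.head) := by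
    simpa using hσ 0
  have e : subst σ (app (app (app (var 0) (lam step))
      (pairTerm (church 0) (rename Nat.succ s))) sndTerm) =
      app (app (app (σ 0) (subst σ (lam step)))
        (pairTerm (church 0) (subst (fun i => σ (i + 1)) s))) sndTerm := by
    rw [subst, subst, subst, subst_pairTerm, subst_church, subst_rename]
    rfl
  rw [e]
  exact (((h0.app (.refl _)).app (.refl _)).app (.refl _)).trans (hiter v.head).2

theorem exists_represents {n : ℕ} {f : List.Vector ℕ n → ℕ} (hf : Nat.Primrec' f) :
    ∃ t, Represents f t := by
  induction hf with
  | zero => exact ⟨church 0, fun v σ _ => by rw [subst_church]; exact .refl _⟩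
  | succ => exact ⟨app succTerm (var 0), fun v σ hσ => by
    refine succTerm_app ?_
    simpa [subst] using hσ 0⟩
  | get i => exact ⟨var i, fun v σ hσ => hσ i⟩
  | @comp m n f g _ _ ihf ihg =>
    obtain ⟨t, ht⟩ := ihf
    choose u hu using ihg
    refine ⟨subst (fun i => if h : i < n then u ⟨i, h⟩ else var i) t, fun v σ hσ => ?_⟩
    rw [subst_subst]
    refine ht _ _ fun i => ?_
    simpa using hu i v σ hσ
  | prec _ _ ihf ihg =>
    obtain ⟨s, hs⟩ := ihf
    obtain ⟨t, ht⟩ := ihg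
    exact hs.prec ht

/-! ### Unbounded search -/

/-- Convertibility says nothing about divergence. Standardization extracts from it the two
abstractions and the variable `0`, each reached by weak head steps, so that the test for zero is
itself weak head reduction. -/
theorem weakHeads_of_betaEq_church_zero {M : LambdaTerm} (hM : BetaEq M (church 0))
    (P Q : LambdaTerm) : WeakHeads (app (app M P) Q) Q := by
  obtain ⟨A, hA, hMA⟩ : ∃ A, WeakHeads M (lam A) ∧ Standard A (lam (var 0)) := by
    cases (hM.betaReduces (isNormal_church 0)).standard with
    | lam h h' => exact ⟨_, h, h'⟩
  obtain ⟨B, hB, hAB⟩ : ∃ B, WeakHeads A (lam B) ∧ Standard B (var 0) := by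
    cases hMA with
    | lam h h' => exact ⟨_, h, h'⟩
  have hB0 : WeakHeads B (var 0) := by
    cases hAB with
    | var h => exact h
  refine ((hA.app P).app Q).trans (.head (.app _ (.beta A P)) ?_)
  refine ((hB.subst (scons P var)).app Q).trans (.head (WeakHead.beta_subst _ _ _) ?_)
  exact hB0.subst _

/-- With `t` computing a function of `y, x₀, …`, the body of the search for the first `y` at
which `t` is positive; the variable `0` is `y`, and `1` is the search itself. -/
def searchBody (t s : LambdaTerm) : LambdaTerm :=
  app (app (subst (scons (var 0) fun i => var (i + 2)) t)
    (lam (rename Nat.succ (subst (scons (var 0) fun i => var (i + 2)) s))))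
    (app (app (var 1) (var 1)) (app succTerm (var 0)))

theorem subst_searchBody (t s L Y : LambdaTerm) (σ : ℕ → LambdaTerm) :
    subst (scons Y (scons L σ)) (searchBody t s) =
      app (app (subst (scons Y σ) t) (lam (rename Nat.succ (subst (scons Y σ) s))))
        (app (app L L) (app succTerm Y)) := by
  have e (u : LambdaTerm) : subst (scons Y (scons L σ))
      (subst (scons (var 0) fun i => var (i + 2)) u) = subst (scons Y σ) u := by
    rw [subst_subst]
    congr 1
    funext i
    cases i <;> rfl
  rw [searchBody, subst, subst, e, subst_lam, subst_rename, ← e s, rename_subst]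
  rfl

/-- Self-application provides the recursion. The value of `t` acts as a test: the numeral `0`
selects the continued search with the next counter, while a positive numeral applies the constant
function at least once and yields the value of `s`. -/
theorem search_unfold (t s Y : LambdaTerm) (σ : ℕ → LambdaTerm) :
    Relation.TransGen WeakHead
      (app (app (subst σ (lam (lam (searchBody t s)))) (subst σ (lam (lam (searchBody t s))))) Y)
      (app (app (subst (scons Y σ) t) (lam (rename Nat.succ (subst (scons Y σ) s))))
        (app (app (subst σ (lam (lam (searchBody t s)))) (subst σ (lam (lam (searchBody t s)))))
          (app succTerm Y))) := by
  rw [← subst_searchBody]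
  exact .head (.app _ (WeakHead.beta_subst _ _ _)) (.single (WeakHead.beta_subst _ _ _))

/-- The abstraction `λx₁ … xₙ.M`. -/
def lams (n : ℕ) (M : LambdaTerm) : LambdaTerm := LambdaTerm.lam^[n] M

theorem betaReduces_foldl_app (l : List ℕ) (M : LambdaTerm) (σ : ℕ → LambdaTerm) :
    BetaReduces (l.foldl (fun M n => app M (church n)) (subst σ (lams l.length M)))
      (subst (l.foldl (fun σ n => scons (church n) σ) σ) M) := by
  have congr {M N : LambdaTerm} (l : List ℕ) (h : BetaReduces M N) :
      BetaReduces (l.foldl (fun M n => app M (church n)) M)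
        (l.foldl (fun M n => app M (church n)) N) := by
    induction l generalizing M N with
    | nil => exact h
    | cons n l ih => exact ih (h.app .refl)
  induction l generalizing σ with
  | nil => exact .refl
  | cons n l ih =>
    refine Relation.ReflTransGen.trans (congr l (.single ?_)) (ih (scons (church n) σ))
    rw [List.length_cons, lams, Function.iterate_succ_apply']
    exact (WeakHead.beta_subst _ _ _).betaStep

/-- The last argument is bound innermost, hence has the index `0`: the tuple appears in reverse. -/
theorem foldl_scons_apply {k : ℕ} (x : Fin k → ℕ) (σ : ℕ → LambdaTerm) (i : Fin k) :
    (List.ofFn x).foldl (fun σ n => scons (church n) σ) σ i = church (x i.rev) := by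
  have h (l : List ℕ) (i : ℕ) (hi : i < l.length) :
      l.foldr (fun n σ => scons (church n) σ) σ i = church l[i] := by
    induction l generalizing i with
    | nil => cases hi
    | cons n l ih =>
      cases i with
      | zero => rfl
      | succ i => exact ih i (Nat.lt_of_succ_lt_succ hi)
  rw [← List.foldr_reverse, h _ _ (by simp)]
  simp only [List.getElem_reverse, List.getElem_ofFn]
  congr 2
  ext
  simp [Fin.val_rev]
  omega

end LambdaTerm

open LambdaTerm in
-- Kleene's normal form: evaluation with bounded resources `evaln` is primitive recursive, and one
-- search for a sufficient bound remains.
theorem lambdaDefinable_of_partrec {k : ℕ} {f : (Fin k → ℕ) →. ℕ} (hf : Partrec f) :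
    LambdaDefinable f := by
  have hrev : Primrec fun (v : List.Vector ℕ k) (i : Fin k) => v.get i.rev :=
    Primrec.fin_curry.2 (Primrec.vector_get.comp Primrec.fst
      ((Primrec.dom_finite Fin.rev).comp Primrec.snd))
  obtain ⟨c, hc⟩ := Nat.Partrec.Code.exists_code.1 (hf.comp hrev.to_comp)
  -- The value is `0` if the bound does not suffice, and `p + 1` if the result is `p`. So the test
  -- for zero controls the search and the predecessor gives the result.
  let g : List.Vector ℕ (k + 1) → ℕ :=
    fun w => Encodable.encode (c.evaln w.head (Encodable.encode w.tail))
  have hg : Primrec g :=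
    Primrec.encode.comp (Nat.Partrec.Code.primrec_evaln.comp
      ((Primrec.vector_head.pair (Primrec.const c)).pair (Primrec.encode.comp Primrec.vector_tail)))
  obtain ⟨t, ht⟩ := exists_represents (Nat.Primrec'.of_prim hg)
  obtain ⟨s, hs⟩ := exists_represents (Nat.Primrec'.of_prim (Primrec.pred.comp hg))
  refine ⟨lams k (app (app (lam (lam (searchBody t s))) (lam (lam (searchBody t s)))) (church 0)),
    fun x => ?_⟩
  let σ : ℕ → LambdaTerm := (List.ofFn x).foldl (fun σ n => scons (church n) σ) var
  let v : List.Vector ℕ k := List.Vector.ofFn fun i => x i.rev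
  let L : LambdaTerm := subst σ (lam (lam (searchBody t s)))
  have hred : BetaReduces
      ((lams k (app (app (lam (lam (searchBody t s))) (lam (lam (searchBody t s))))
        (church 0))).appNumerals x) (app (app L L) (church 0)) := by
    have h := betaReduces_foldl_app (List.ofFn x)
      (app (app (lam (lam (searchBody t s))) (lam (lam (searchBody t s)))) (church 0)) var
    rw [List.length_ofFn, subst_var] at h
    exact h
  have hσ {Y : LambdaTerm} {y : ℕ} (hY : BetaEq Y (church y)) (i : Fin (k + 1)) :
      BetaEq (scons Y σ i) (church ((y ::ᵥ v).get i)) := by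
    refine Fin.cases hY (fun i => ?_) i
    have := foldl_scons_apply x var i
    rw [List.Vector.get_cons_succ, List.Vector.get_ofFn, ← this]
    exact .refl _
  have hmem (p : ℕ) : p ∈ f x ↔ ∃ y, g (y ::ᵥ v) = p + 1 := by
    have : p ∈ f x ↔ p ∈ c.eval (Encodable.encode v) := by
      rw [hc]
      simp [v]
    rw [this, Nat.Partrec.Code.evaln_complete]
    refine exists_congr fun y => ?_
    simp only [g, List.Vector.head_cons, List.Vector.tail_cons]
    cases c.evaln y (Encodable.encode v) <;> simp
  have hstep {Y : LambdaTerm} {y : ℕ} (hY : BetaEq Y (church y)) (hy : g (y ::ᵥ v) = 0) :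
      Relation.TransGen WeakHead (app (app L L) Y) (app (app L L) (app succTerm Y)) := by
    have h := ht (y ::ᵥ v) _ (hσ hY)
    rw [hy] at h
    exact (search_unfold t s Y σ).trans_left (weakHeads_of_betaEq_church_zero h _ _)
  constructor
  · intro p hp
    obtain ⟨y, hy⟩ := (hmem p).1 hp
    refine hred.betaEq.trans ?_
    have hfound (i q : ℕ) (hi : g (i ::ᵥ v) = q + 1) :
        BetaEq (app (app L L) (church i)) (church q) := by
      have h := ht (i ::ᵥ v) _ (hσ (.refl _))
      have h' := hs (i ::ᵥ v) _ (hσ (.refl _))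
      simp only [hi, Nat.pred_succ] at h h'
      refine (WeakHeads.betaEq (search_unfold t s (church i) σ).to_reflTransGen).trans ?_
      refine ((h.app (.refl _)).app (.refl _)).trans ((church_succ_app _ _ _).trans ?_)
      refine BetaEq.trans (.rel _ _ (.beta _ _)) ?_
      rwa [inst_rename_succ]
    -- Induction on the distance to a bound known to suffice. A smaller bound may succeed earlier,
    -- with the same value since `f x` has only one.
    have key (j i : ℕ) (hij : i + j = y) : BetaEq (app (app L L) (church i)) (church p) := by
      induction j generalizing i with
      | zero => exact hfound i p (by rwa [← hij] at hy)
      | succ j ih =>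
        rcases hi : g (i ::ᵥ v) with _ | q
        · refine (WeakHeads.betaEq (hstep (.refl _) hi).to_reflTransGen).trans ?_
          exact ((BetaEq.refl _).app (succTerm_app (.refl _))).trans (ih (i + 1) (by omega))
        · exact Part.mem_unique hp ((hmem q).2 ⟨i, hi⟩) ▸ hfound i q hi
    exact key y 0 (Nat.zero_add y)
  · intro hx hn
    have h0 (y : ℕ) : g (y ::ᵥ v) = 0 := by
      by_contra h
      obtain ⟨p, hp⟩ := Nat.exists_eq_succ_of_ne_zero h
      exact hx (((hmem p).2 ⟨y, hp⟩).1)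
    obtain ⟨N, hN, hNn⟩ := hn
    refine not_hasNormalForm_of_weakHead
      (S := {M | ∃ Y, (∃ y, BetaEq Y (church y)) ∧ M = app (app L L) Y}) ?_
      ⟨_, ⟨0, .refl _⟩, rfl⟩ 
      ⟨N, (hred.betaEq.symm.trans (BetaReduces.betaEq hN)).betaReduces hNn, hNn⟩
    rintro _ ⟨Y, ⟨y, hY⟩, rfl⟩
    exact ⟨_, ⟨_, ⟨y + 1, succTerm_app hY⟩, rfl⟩, hstep hY (h0 y)⟩

namespace LambdaTerm

/-! ### Coding of terms by natural numbers -/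

/-- A bijective coding of terms. -/
def code : LambdaTerm → ℕ
  | var n => 3 * n
  | lam M => 3 * code M + 1
  | app M N => 3 * Nat.pair (code M) (code N) + 2

/-- The term with a given code. -/
def ofCode (n : ℕ) : LambdaTerm :=
  if n % 3 = 0 then var (n / 3)
  else if n % 3 = 1 then lam (ofCode (n / 3))
  else app (ofCode (n / 3).unpair.1) (ofCode (n / 3).unpair.2)
decreasing_by
  · omega
  · have := Nat.unpair_left_le (n / 3)
    omega
  · have := Nat.unpair_right_le (n / 3)
    omega

theorem ofCode_code (M : LambdaTerm) : ofCode (code M) = M := by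
  induction M with
  | var n =>
    rw [code, ofCode, if_pos (by omega)]
    congr 1
    omega
  | lam M ih =>
    rw [code, ofCode, if_neg (by omega), if_pos (by omega),
      show (3 * code M + 1) / 3 = code M by omega, ih]
  | app M N ihM ihN =>
    rw [code, ofCode, if_neg (by omega), if_neg (by omega),
      show (3 * Nat.pair (code M) (code N) + 2) / 3 = Nat.pair (code M) (code N) by omega,
      Nat.unpair_pair, ihM, ihN]

theorem code_ofCode (n : ℕ) : code (ofCode n) = n := by
  induction n using Nat.strong_induction_on with
  | _ n ih =>
    rw [ofCode]
    split_ifs with h₀ h₁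
    · rw [code]
      omega
    · rw [code, ih _ (by omega)]
      omega
    · have h₂ := Nat.unpair_left_le (n / 3)
      have h₃ := Nat.unpair_right_le (n / 3)
      rw [code, ih _ (by omega), ih _ (by omega), Nat.pair_unpair]
      omega

/-- The coding as a bijection. -/
def codeEquiv : LambdaTerm ≃ ℕ := ⟨code, ofCode, ofCode_code, code_ofCode⟩

instance instPrimcodable : Primcodable LambdaTerm := Primcodable.ofEquiv ℕ codeEquiv

theorem primrec_code : Primrec code := Primrec.of_equiv (e := codeEquiv)

theorem primrec_ofCode : Primrec ofCode := Primrec.of_equiv_symm (e := codeEquiv)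

theorem primrec_var : Primrec var :=
  (primrec_ofCode.comp (Primrec.nat_mul.comp (Primrec.const 3) Primrec.id)).of_eq
    fun n => ofCode_code (var n)

theorem primrec_lam : Primrec lam :=
  (primrec_ofCode.comp (Primrec.nat_add.comp
    (Primrec.nat_mul.comp (Primrec.const 3) primrec_code) (Primrec.const 1))).of_eq
    fun M => ofCode_code (lam M)

theorem primrec_app : Primrec₂ app :=
  (primrec_ofCode.comp (Primrec.nat_add.comp (Primrec.nat_mul.comp (Primrec.const 3)
    (Primrec₂.natPair.comp (primrec_code.comp Primrec.fst) (primrec_code.comp Primrec.snd)))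
    (Primrec.const 2))).of_eq fun p => ofCode_code (app p.1 p.2)

/-- The kind of a term: `0` for a variable, `1` for an abstraction, `2` for an application. -/
def kind (M : LambdaTerm) : ℕ := code M % 3

theorem primrec_kind : Primrec kind := Primrec.nat_mod.comp primrec_code (Primrec.const 3)

theorem primrec_code_div : Primrec fun M => code M / 3 :=
  Primrec.nat_div.comp primrec_code (Primrec.const 3)

/-- Structural recursion becomes course-of-values recursion along the code, which decreases to
subterms. The parameter may change under an abstraction, and `A` also receives the original function
part, which `develop` has to inspect. -/
theorem primrec_of_structural {α : Type*} [Primcodable α] {f : α × LambdaTerm → LambdaTerm}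
    {p : α → α} {V : α × ℕ → LambdaTerm}
    {A : LambdaTerm × LambdaTerm × LambdaTerm → LambdaTerm} (hp : Primrec p) (hV : Primrec V)
    (hA : Primrec A) (hvar : ∀ a n, f (a, var n) = V (a, n))
    (happ : ∀ a M N, f (a, app M N) = A (M, f (a, M), f (a, N)))
    (hlam : ∀ a M, f (a, lam M) = lam (f (p a, M))) : Primrec f := by
  let left (M : LambdaTerm) : LambdaTerm := ofCode (code M / 3).unpair.1
  let right (M : LambdaTerm) : LambdaTerm := ofCode (code M / 3).unpair.2
  have hleft : Primrec left :=
    primrec_ofCode.comp (Primrec.fst.comp (Primrec.unpair.comp primrec_code_div))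
  have hright : Primrec right :=
    primrec_ofCode.comp (Primrec.snd.comp (Primrec.unpair.comp primrec_code_div))
  have hbody : Primrec fun M => ofCode (code M / 3) := primrec_ofCode.comp primrec_code_div
  have hkind {β : Type _} [Primcodable β] {g : β → LambdaTerm} (hg : Primrec g) (n : ℕ) :
      PrimrecPred fun b => kind (g b) = n :=
    Primrec.eq.comp (primrec_kind.comp hg) (Primrec.const n)
  refine Primrec.nat_omega_rec' f (m := fun b => code b.2)
    (l := fun b => if kind b.2 = 0 then [] else if kind b.2 = 1 then [(p b.1, ofCode (code b.2 / 3))]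
      else [(b.1, left b.2), (b.1, right b.2)])
    (g := fun b r => if kind b.2 = 0 then some (V (b.1, code b.2 / 3))
      else if kind b.2 = 1 then r[0]?.map lam
      else r[0]?.bind fun M => r[1]?.map fun N => A (left b.2, M, N))
    (primrec_code.comp Primrec.snd) ?_ ?_ ?_ ?_
  · refine Primrec.ite (hkind Primrec.snd 0) (Primrec.const _)
      (Primrec.ite (hkind Primrec.snd 1) ?_ ?_)
    · exact Primrec.list_cons.comp
        ((hp.comp Primrec.fst).pair (hbody.comp Primrec.snd)) (Primrec.const _)
    · exact Primrec.list_cons.comp (Primrec.fst.pair (hleft.comp Primrec.snd))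
        (Primrec.list_cons.comp (Primrec.fst.pair (hright.comp Primrec.snd)) (Primrec.const _))
  · have hM : Primrec fun q : (α × LambdaTerm) × List LambdaTerm => q.1.2 :=
      Primrec.snd.comp Primrec.fst
    have hr (n : ℕ) : Primrec fun q : (α × LambdaTerm) × List LambdaTerm => q.2[n]? :=
      Primrec.list_getElem?.comp Primrec.snd (Primrec.const n)
    refine Primrec.ite (hkind hM 0) ?_ (Primrec.ite (hkind hM 1) ?_ ?_)
    · exact Primrec.option_some.comp (hV.comp
        ((Primrec.fst.comp Primrec.fst).pair (primrec_code_div.comp hM)))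
    · exact Primrec.option_map (hr 0) (primrec_lam.comp Primrec.snd).to₂
    · have h : Primrec fun q : (((α × LambdaTerm) × List LambdaTerm) × LambdaTerm) × LambdaTerm =>
          (left q.1.1.1.2, q.1.2, q.2) :=
        ((hleft.comp hM).comp (Primrec.fst.comp Primrec.fst)).pair
          ((Primrec.snd.comp Primrec.fst).pair Primrec.snd)
      exact Primrec.option_bind (hr 0)
        (Primrec.option_map ((hr 1).comp Primrec.fst) (hA.comp h).to₂).to₂
  · rintro ⟨a, M⟩ ⟨a', M'⟩ h
    have h₂ := Nat.unpair_left_le (code M / 3)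
    have h₃ := Nat.unpair_right_le (code M / 3)
    dsimp only at h ⊢
    split_ifs at h with hk₀ hk₁
    · cases h
    · rw [List.mem_singleton, Prod.mk.injEq] at h
      rw [h.2, code_ofCode]
      rw [kind] at hk₁
      omega
    · rw [kind] at hk₀
      simp only [List.mem_cons, List.not_mem_nil, or_false, Prod.mk.injEq] at h
      rcases h with h | h <;> rw [h.2, code_ofCode] <;> omega
  · rintro ⟨a, M⟩
    cases M with
    | var n =>
      have h₀ : kind (var n) = 0 := by rw [kind, code]; omega
      have h₁ : code (var n) / 3 = n := by rw [code]; omega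
      simp only [h₀, h₁, if_true, hvar]
    | lam M =>
      have h₀ : kind (lam M) = 1 := by rw [kind, code]; omega
      have h₁ : code (lam M) / 3 = code M := by rw [code]; omega
      simp [h₀, h₁, ofCode_code, hlam]
    | app M N =>
      have h₀ : kind (app M N) = 2 := by rw [kind, code]; omega
      have h₁ : code (app M N) / 3 = Nat.pair (code M) (code N) := by rw [code]; omega
      simp [left, right, h₀, h₁, ofCode_code, happ]

/-- The renaming that makes room for a new variable `c`. -/
def shiftAt (c n : ℕ) : ℕ := if n < c then n else n + 1

/-- Arbitrary renamings and substitutions have no codes. Those that arise from `Nat.succ` and from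
`inst` under abstractions form families with a finite description, closed under passing below a
binder. -/
theorem upRen_shiftAt (c : ℕ) : upRen (shiftAt c) = shiftAt (c + 1) := by
  funext n
  cases n with
  | zero => rfl
  | succ n =>
    change shiftAt c n + 1 = _
    simp only [shiftAt, Nat.add_lt_add_iff_right]
    split_ifs <;> rfl

theorem primrec_rename_shiftAt :
    Primrec fun q : ℕ × LambdaTerm => rename (shiftAt q.1) q.2 :=
  primrec_of_structural (V := fun q => var (shiftAt q.1 q.2)) (A := fun q => app q.2.1 q.2.2)
    Primrec.succ
    (primrec_var.comp (Primrec.ite (Primrec.nat_lt.comp Primrec.snd Primrec.fst) Primrec.snd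
      (Primrec.succ.comp Primrec.snd)))
    (primrec_app.comp (Primrec.fst.comp Primrec.snd) (Primrec.snd.comp Primrec.snd))
    (fun _ _ => rfl) (fun _ _ _ => rfl)
    fun c M => by rw [rename_lam, upRen_shiftAt]

theorem primrec_rename_succ : Primrec (rename Nat.succ) :=
  primrec_rename_shiftAt.comp ((Primrec.const 0).pair Primrec.id)

/-- The substitution of `N` for the variable `c`, the later variables being renumbered. -/
def substAt (c : ℕ) (N : LambdaTerm) (n : ℕ) : LambdaTerm :=
  if n < c then var n else if n = c then N else var (n - 1)

theorem up_substAt (c : ℕ) (N : LambdaTerm) :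
    up (substAt c N) = substAt (c + 1) (rename Nat.succ N) := by
  funext n
  cases n with
  | zero => rfl
  | succ n =>
    change rename Nat.succ (substAt c N n) = _
    simp only [substAt, Nat.add_lt_add_iff_right, Nat.add_right_cancel_iff]
    split_ifs with h₀ h₁
    · rfl
    · rfl
    · simp only [rename]
      congr 1
      omega

theorem primrec_subst_substAt :
    Primrec fun q : (ℕ × LambdaTerm) × LambdaTerm => subst (substAt q.1.1 q.1.2) q.2 := by
  have hc : Primrec fun q : (ℕ × LambdaTerm) × ℕ => q.1.1 := Primrec.fst.comp Primrec.fst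
  exact primrec_of_structural (V := fun q => substAt q.1.1 q.1.2 q.2)
    (A := fun q => app q.2.1 q.2.2)
    ((Primrec.succ.comp Primrec.fst).pair (primrec_rename_succ.comp Primrec.snd))
    (Primrec.ite (Primrec.nat_lt.comp Primrec.snd hc) (primrec_var.comp Primrec.snd)
      (Primrec.ite (Primrec.eq.comp Primrec.snd hc) (Primrec.snd.comp Primrec.fst)
        (primrec_var.comp (Primrec.pred.comp Primrec.snd))))
    (primrec_app.comp (Primrec.fst.comp Primrec.snd) (Primrec.snd.comp Primrec.snd))
    (fun _ _ => rfl) (fun _ _ _ => rfl)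
    fun q M => by rw [subst_lam, up_substAt]

theorem primrec_inst : Primrec₂ inst :=
  (primrec_subst_substAt.comp
    (((Primrec.const 0).pair Primrec.snd).pair Primrec.fst)).of_eq fun q => by
      rw [inst_eq]
      congr 1
      funext n
      cases n <;> rfl

theorem primrec_develop : Primrec develop := by
  have h : Primrec fun q : Unit × LambdaTerm => develop q.2 := by
    refine primrec_of_structural (p := id) (V := fun q => var q.2)
      (A := fun q => if kind q.1 = 1 then inst (ofCode (code q.2.1 / 3)) q.2.2 else app q.2.1 q.2.2)
      Primrec.id (primrec_var.comp Primrec.snd)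
      (Primrec.ite (Primrec.eq.comp (primrec_kind.comp Primrec.fst) (Primrec.const 1)) ?_ ?_)
      (fun _ _ => rfl) (fun _ M N => ?_) (fun _ _ => rfl)
    · exact primrec_inst.comp
        ((primrec_ofCode.comp primrec_code_div).comp (Primrec.fst.comp Primrec.snd))
        (Primrec.snd.comp Primrec.snd)
    · exact primrec_app.comp (Primrec.fst.comp Primrec.snd) (Primrec.snd.comp Primrec.snd)
    · cases M with
      | var n =>
        rw [if_neg (by rw [kind, code]; omega)]
        rfl
      | app P Q =>
        rw [if_neg (by rw [kind, code]; omega)]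
        rfl
      | lam P =>
        rw [if_pos (by rw [kind, code]; omega)]
        dsimp only [develop]
        rw [show code (lam (develop P)) / 3 = code (develop P) by rw [code]; omega, ofCode_code]
        rfl
  exact h.comp ((Primrec.const ()).pair Primrec.id)

theorem primrec_church : Primrec church := by
  have h : Primrec churchBody :=
    (Primrec.nat_iterate Primrec.id (Primrec.const (var 0))
      (primrec_app.comp (Primrec.const (var 1)) Primrec.snd).to₂).of_eq fun n => by
        induction n with
        | zero => rfl
        | succ n ih =>
          rw [id, Function.iterate_succ_apply']
          exact congrArg (app (var 1)) ih
  exact primrec_lam.comp (primrec_lam.comp h)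

theorem primrec_appNumerals {k : ℕ} (F : LambdaTerm) :
    Primrec fun x : Fin k → ℕ => F.appNumerals x :=
  Primrec.list_foldl
    (Primrec.list_ofFn fun i => Primrec.fin_app.comp Primrec.id (Primrec.const i))
    (Primrec.const F)
    (primrec_app.comp (Primrec.fst.comp Primrec.snd)
      (primrec_church.comp (Primrec.snd.comp Primrec.snd))).to₂

end LambdaTerm

open LambdaTerm in
-- The search runs over pairs of a number of developments and a candidate value. It succeeds exactly
-- if some development of the term is a numeral.
theorem LambdaDefinable.partrec {k : ℕ} {f : (Fin k → ℕ) →. ℕ} (hf : LambdaDefinable f) :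
    Partrec f := by
  obtain ⟨F, hF⟩ := hf
  let s (x : Fin k → ℕ) (n : ℕ) : Option ℕ :=
    if code (develop^[n.unpair.1] (F.appNumerals x)) = code (church n.unpair.2)
    then some n.unpair.2 else none
  have hs : Primrec₂ s := by
    have h₁ : Primrec fun q : (Fin k → ℕ) × ℕ => q.2.unpair.1 :=
      Primrec.fst.comp (Primrec.unpair.comp Primrec.snd)
    have h₂ : Primrec fun q : (Fin k → ℕ) × ℕ => q.2.unpair.2 :=
      Primrec.snd.comp (Primrec.unpair.comp Primrec.snd)
    exact Primrec.ite (Primrec.eq.comp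
      (primrec_code.comp (Primrec.nat_iterate h₁ ((primrec_appNumerals F).comp Primrec.fst)
        (primrec_develop.comp Primrec.snd).to₂))
      (primrec_code.comp (primrec_church.comp h₂)))
      (Primrec.option_some.comp h₂) (Primrec.const none)
  refine (Partrec.rfindOpt hs.to_comp).of_eq fun x => Part.ext fun p => ?_
  have hmem (n p : ℕ) : p ∈ s x n ↔
      n.unpair.2 = p ∧ develop^[n.unpair.1] (F.appNumerals x) = church p := by
    have hinj := Function.LeftInverse.injective ofCode_code
    simp only [s, Option.mem_def, Option.ite_none_right_eq_some, hinj.eq_iff, Option.some.injEq]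
    exact ⟨fun h => ⟨h.2, h.2 ▸ h.1⟩, fun h => ⟨h.1 ▸ h.2, h.1⟩⟩
  -- A numeral that is found is a normal form, so `f x` is defined, and uniqueness of normal forms
  -- makes the numeral its value.
  have hsound (p : ℕ) (hp : p ∈ Nat.rfindOpt (s x)) : p ∈ f x := by
    obtain ⟨n, hn⟩ := Nat.rfindOpt_spec hp
    have hred := betaReduces_iterate_develop n.unpair.1 (F.appNumerals x)
    rw [((hmem n p).1 hn).2] at hred
    by_cases hx : (f x).Dom
    · have h := ((hF x).1 _ (Part.get_mem hx)).symm.trans (BetaReduces.betaEq hred)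
      have := (isNormal_church _).eq_of_betaReduces (h.betaReduces (isNormal_church p))
      rw [church_injective this]
      exact Part.get_mem hx
    · exact ((hF x).2 hx ⟨_, hred, isNormal_church p⟩).elim
  refine ⟨hsound p, fun hp => ?_⟩
  obtain ⟨n, hn⟩ := ((hF x).1 p hp).exists_iterate_develop_eq (isNormal_church p)
  have hdom : (Nat.rfindOpt (s x)).Dom :=
    Nat.rfindOpt_dom.2 ⟨Nat.pair n p, p, (hmem _ _).2 (by simpa using hn)⟩
  have hget := Part.get_mem hdom
  rwa [← Part.mem_unique (hsound _ hget) hp]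

end ClassicModels

theorem mainTheorem1 (k : ℕ) (f : (Fin k → ℕ) →. ℕ) :
    (ClassicModels.TuringComputable f ↔ ClassicModels.PartialRecursive f) ∧
      (ClassicModels.PartialRecursive f ↔ ClassicModels.LambdaDefinable f) ∧
      (ClassicModels.LambdaDefinable f ↔ ClassicModels.TuringComputable f) := by
  have hTR : ClassicModels.TuringComputable f ↔ ClassicModels.PartialRecursive f :=
    ⟨fun h => ClassicModels.partialRecursive_iff_partrec.2 h.partrec,
      fun h => ClassicModels.turingComputable_of_partrec
        (ClassicModels.partialRecursive_iff_partrec.1 h)⟩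
  have hRL : ClassicModels.PartialRecursive f ↔ ClassicModels.LambdaDefinable f :=
    ⟨fun h => ClassicModels.lambdaDefinable_of_partrec
        (ClassicModels.partialRecursive_iff_partrec.1 h),
      fun h => ClassicModels.partialRecursive_iff_partrec.2 h.partrec⟩
  exact ⟨hTR, hRL, hRL.symm.trans hTR.symm⟩
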